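/- Consider the 3-majority dynamics on $n$ nodes, each holding one of $k$ opinions $1,\dots,k$: in every synchronous round, each node independently pulls two independent uniformly random nodes (with replacement, possibly itself); if the two pulled nodes hold the same opinion, it adopts that opinion, and otherwise it keeps its own. (There is no adversary.) For a configuration let $p_i$ be the fraction of nodes holding opinion $i$ and $p_{\max}=\max_i p_i$. Call opinion $i$ super-weak if $p_i\le \frac1{10k}$ and strong if $p_i\ge p_{\max}/5$. For two opinions $i\ne j$ with $p_i,p_j>0$ let $g_{ij}=\frac{p_i-p_j}{p_j}$. Lemma (Property (P2)). There is a constant $\delta_0>0$ such that for every constant $\delta\in(0,\delta_0]$ and every constant $C_1>0$ there is a constant $C_2>0$ (depending only on $C_1$ and $\delta$) for which the following holds. For every $K>0$ there is $n_0$ such that for all $n\ge n_0$, all $k\le K\sqrt{n/\log n}$ and every epoch $e\ge1$ with $\kappa:=\lfloor k(5/6)^{e-1}\rfloor\ge 2$: suppose that a phase, i.e. a sequence of $\lceil\delta\kappa\rceil$ consecutive rounds, starts in a configuration in which at most $\kappa$ opinions are not super-weak and $p_{\max}\le \frac{1.5}{\kappa}$, and let $i\neq j$ be two opinions that are strong in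 this configuration. Then, with probability at least $C_2$, at the end of the phase $p_i,p_j>0$ and $$\max\{g_{ij},g_{ji}\}\ \ge\ \frac{C_1}{\sqrt{n/\kappa}} .$$ -/

import Mathlib

namespace ThreeMajority

/-- A configuration: each of the `n` nodes holds one of the `k` opinions. -/
abbrev Config (n k : ℕ) : Type := Fin n → Fin k

/-- One synchronous round, given the pair of nodes `s v` pulled by every node `v`: the new opinion
of `v` is the majority of its own opinion and the two pulled ones, ties being broken towards its
own opinion. That is, `v` adopts the opinion of the pulled nodes if these agree, and otherwise
keeps its own. -/
def update {n k : ℕ} (x : Config n k) (s : Fin n → Fin n × Fin n) : Config n k :=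
  fun v => if x (s v).1 = x (s v).2 then x (s v).1 else x v

/-- The law of the configuration after one round started from `x`: all nodes independently pull
two independent uniformly random nodes, so the family of pulled pairs is uniform. -/
noncomputable def round {n k : ℕ} [NeZero n] (x : Config n k) : PMF (Config n k) :=
  (PMF.uniformOfFintype (Fin n → Fin n × Fin n)).map (update x)

/-- The law of the configuration after `T` rounds of the 3-majority dynamics started from `x`. -/
noncomputable def rounds {n k : ℕ} [NeZero n] : ℕ → Config n k → PMF (Config n k)
  | 0, x => PMF.pure x
  | T + 1, x => (round x).bind (rounds T)

/-- The fraction `p_i` of nodes that hold opinion `i`. -/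
noncomputable def frac {n k : ℕ} (x : Config n k) (i : Fin k) : ℝ :=
  ((Finset.univ.filter fun v => x v = i).card : ℝ) / n

/-- The largest fraction `p_max`. -/
noncomputable def maxFrac {n k : ℕ} (x : Config n k) : ℝ := ⨆ i : Fin k, frac x i

/-- Opinion `i` is super-weak: `p_i ≤ 1 / (10 k)`. -/
def IsSuperWeak {n k : ℕ} (x : Config n k) (i : Fin k) : Prop := frac x i ≤ 1 / (10 * (k : ℝ))

/-- Opinion `i` is strong: `p_i ≥ p_max / 5`. -/
def IsStrong {n k : ℕ} (x : Config n k) (i : Fin k) : Prop := maxFrac x / 5 ≤ frac x i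

/-- The parameter `κ = ⌊k (5/6)^(e-1)⌋` of the `e`-th epoch, `e = 1, 2, …`. -/
noncomputable def epochSize (k e : ℕ) : ℕ := ⌊(k : ℝ) * (5 / 6 : ℝ) ^ (e - 1)⌋₊

/-- A phase consists of `δ κ` rounds (rounded up, so that it has at least one round). -/
noncomputable def phaseLength (δ : ℝ) (κ : ℕ) : ℕ := ⌈δ * (κ : ℝ)⌉₊

/-- The gap `g_ij = (p_i - p_j) / p_j`. -/
noncomputable def gap {n k : ℕ} (x : Config n k) (i j : Fin k) : ℝ :=
  (frac x i - frac x j) / frac x j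

end ThreeMajority

namespace ThreeMajority

/-! Let `D` be the number of nodes with opinion `i` minus the number with opinion `j`, and suppose
that all fractions are at most `β = O(1/κ)` while `p_i, p_j` are at least `0.03/κ`. One round
multiplies the mean of `D` by `1 + p_i + p_j - ∑ p_l²`, which lies between `1 - β` and `1 + 2β`, and
adds independent noise of variance of order `n/κ²`. Over about `δκ` rounds the drift therefore costs
only constant factors (between `1/4` and `5`, as `β T ≤ 3/4`), while the noise accumulates variance
of order `n/κ`. So `|D|` exceeds any fixed multiple of `√(n/κ)` with constant probability, and
dividing by the smaller of the two opinion counts, which is `O(n/κ)`, turns this into the gap.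

Anticoncentration is obtained without a central limit theorem. The function `cosh (θ D)` is even and
increasing in `|D|`, so the direction of the drift is irrelevant. Nodes are independent given the
configuration, so its mean is bounded on both sides round by round (`le_killedMean_cosh`,
`killedMean_cosh_le`). With `θ` tuned in `exists_exponent`, the Paley–Zygmund inequality
`paley_zygmund_killedMean` gives a constant probability.

The one-round bounds need a good configuration, so the dynamics is killed on leaving `goodSet`, and
killed runs are first counted as successes. Their probability is then subtracted: exponential
potentials for single opinions bound it by `(k + 2) exp(-(n/κ)/2500)`, which tends to zero because
`k = O(√n)`. The pieces meet in `exists_le_rounds_real`. -/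

variable {n k : ℕ}

/-! ### One-round expectations and the killed dynamics. -/

/-- The expectation of `f` after one round started from `x`. -/
noncomputable def stepMean (x : Config n k) (f : Config n k → ℝ) : ℝ :=
  (∑ s : Fin n → Fin n × Fin n, f (update x s)) / Fintype.card (Fin n → Fin n × Fin n)

open Classical in
/-- The dynamics run for `T` rounds and killed at the first of the times `0, …, T - 1` at which it
is outside `G`: the expectation of the payoff `F` at time `T` if the dynamics survives, and `H` at
the time of the killing otherwise. -/
noncomputable def killedMean (G : Set (Config n k)) (F H : Config n k → ℝ) :
    ℕ → Config n k → ℝ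
  | 0, x => F x
  | t + 1, x => if x ∈ G then stepMean x (killedMean G F H t) else H x

theorem stepMean_mono (x : Config n k) {f g : Config n k → ℝ} (h : ∀ y, f y ≤ g y) :
    stepMean x f ≤ stepMean x g := by
  unfold stepMean
  gcongr
  exact h _

theorem stepMean_add (x : Config n k) (f g : Config n k → ℝ) :
    stepMean x (fun y => f y + g y) = stepMean x f + stepMean x g := by
  simp only [stepMean, Finset.sum_add_distrib, add_div]

theorem stepMean_const_mul (x : Config n k) (c : ℝ) (f : Config n k → ℝ) :
    stepMean x (fun y => c * f y) = c * stepMean x f := by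
  simp only [stepMean, ← Finset.mul_sum, mul_div_assoc]

theorem stepMean_const [NeZero n] (x : Config n k) (c : ℝ) : stepMean x (fun _ => c) = c := by
  unfold stepMean
  rw [Finset.sum_const, Finset.card_univ, nsmul_eq_mul, mul_div_cancel_left₀]
  exact_mod_cast Fintype.card_ne_zero

section Killed

variable (G : Set (Config n k))

/-- A comparison principle in place of optional stopping. The index `t` counts the rounds still to
come, so a supersolution `h` only has to be checked for one round inside `G` and against the payoff
outside. -/
theorem killedMean_le_of_super {F H : Config n k → ℝ} {h : ℕ → Config n k → ℝ} {T : ℕ}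
    (h0 : ∀ x, F x ≤ h 0 x) (hout : ∀ t < T, ∀ x ∉ G, H x ≤ h (t + 1) x)
    (hin : ∀ t < T, ∀ x ∈ G, stepMean x (h t) ≤ h (t + 1) x) :
    ∀ t ≤ T, ∀ x, killedMean G F H t x ≤ h t x := by
  intro t
  induction t with
  | zero => exact fun _ x => h0 x
  | succ t ih =>
    intro ht x
    rw [killedMean]
    split_ifs with hx
    · exact (stepMean_mono x (ih (by omega))).trans (hin t (by omega) x hx)
    · exact hout t (by omega) x hx

theorem le_killedMean_of_sub {F H : Config n k → ℝ} {h : ℕ → Config n k → ℝ} {T : ℕ}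
    (h0 : ∀ x, h 0 x ≤ F x) (hout : ∀ t < T, ∀ x ∉ G, h (t + 1) x ≤ H x)
    (hin : ∀ t < T, ∀ x ∈ G, h (t + 1) x ≤ stepMean x (h t)) :
    ∀ t ≤ T, ∀ x, h t x ≤ killedMean G F H t x := by
  intro t
  induction t with
  | zero => exact fun _ x => h0 x
  | succ t ih =>
    intro ht x
    rw [killedMean]
    split_ifs with hx
    · exact (hin t (by omega) x hx).trans (stepMean_mono x (ih (by omega)))
    · exact hout t (by omega) x hx

theorem killedMean_mono {F F' H H' : Config n k → ℝ} (hF : ∀ x, F x ≤ F' x)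
    (hH : ∀ x ∉ G, H x ≤ H' x) (T : ℕ) (x : Config n k) :
    killedMean G F H T x ≤ killedMean G F' H' T x := by
  refine killedMean_le_of_super G (h := killedMean G F' H') hF ?_ ?_ T le_rfl x
  · intro t _ y hy
    rw [killedMean, if_neg hy]
    exact hH y hy
  · intro t _ y hy
    rw [killedMean, if_pos hy]

theorem killedMean_add (F F' H H' : Config n k → ℝ) (T : ℕ) (x : Config n k) :
    killedMean G (fun y => F y + F' y) (fun y => H y + H' y) T x =
      killedMean G F H T x + killedMean G F' H' T x := by
  induction T generalizing x with
  | zero => rfl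
  | succ T ih =>
    simp only [killedMean]
    split_ifs
    · rw [← stepMean_add]
      exact congrArg _ (funext ih)
    · rfl

theorem killedMean_const_mul (c : ℝ) (F H : Config n k → ℝ) (T : ℕ) (x : Config n k) :
    killedMean G (fun y => c * F y) (fun y => c * H y) T x = c * killedMean G F H T x := by
  induction T generalizing x with
  | zero => rfl
  | succ T ih =>
    simp only [killedMean]
    split_ifs
    · rw [← stepMean_const_mul]
      exact congrArg _ (funext ih)
    · rfl

theorem killedMean_const [NeZero n] (c : ℝ) (T : ℕ) (x : Config n k) :
    killedMean G (fun _ => c) (fun _ => c) T x = c := by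
  induction T generalizing x with
  | zero => rfl
  | succ T ih =>
    simp only [killedMean]
    split_ifs
    · rw [show killedMean G (fun _ => c) (fun _ => c) T = fun _ => c from funext ih,
        stepMean_const]
    · rfl

theorem killedMean_sum {ι : Type*} (s : Finset ι) (F H : ι → Config n k → ℝ) (T : ℕ)
    (x : Config n k) :
    killedMean G (fun y => ∑ l ∈ s, F l y) (fun y => ∑ l ∈ s, H l y) T x =
      ∑ l ∈ s, killedMean G (F l) (H l) T x := by
  classical
  induction s using Finset.induction_on with
  | empty => simpa using killedMean_const_mul G 0 (fun _ => 0) (fun _ => 0) T x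
  | insert a s ha ih =>
    simp only [Finset.sum_insert ha]
    rw [← ih, ← killedMean_add]

/-- A pointwise substitute for Cauchy–Schwarz: above the threshold it is `(z - α)² ≥ 0`.
Monotonicity and linearity of `killedMean` then suffice for Paley–Zygmund. -/
theorem le_add_indicator_add_sq {z m α : ℝ} (hm : 0 ≤ m) (hα : 0 < α) :
    z ≤ m + α / 2 * (if m < z then 1 else 0) + 1 / (2 * α) * z ^ 2 := by
  have h0 : 0 ≤ 1 / (2 * α) * z ^ 2 := by positivity
  split_ifs with h
  · have : α / 2 + 1 / (2 * α) * z ^ 2 - z = 1 / (2 * α) * (z - α) ^ 2 := by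
      field_simp
      ring
    have h1 : 0 ≤ 1 / (2 * α) * (z - α) ^ 2 := by positivity
    linarith
  · linarith

/-- The Paley–Zygmund inequality for the killed dynamics. -/
theorem paley_zygmund_killedMean [NeZero n] {F H : Config n k → ℝ} {T : ℕ} {x : Config n k}
    {m m' V : ℝ} (hm' : 0 ≤ m') (hmm : m' < m) (hV : 0 < V)
    (h1 : m ≤ killedMean G F H T x)
    (h2 : killedMean G (fun y => F y ^ 2) (fun y => H y ^ 2) T x ≤ V) :
    (m - m') ^ 2 / V ≤
      killedMean G (fun y => if m' < F y then 1 else 0) (fun _ => 1) T x := by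
  set p := killedMean G (fun y => if m' < F y then 1 else 0) (fun _ => 1) T x with hp
  have hd : 0 < m - m' := sub_pos.2 hmm
  -- With `α = V / (m - m')` the quadratic term takes at most half of `m - m'`, leaving the other
  -- half to the indicator.
  have hα : 0 < V / (m - m') := by positivity
  have h3 := killedMean_mono G (F := F) (H := H)
    (F' := fun y => (m' + V / (m - m') / 2 * (if m' < F y then 1 else 0)) +
      1 / (2 * (V / (m - m'))) * F y ^ 2)
    (H' := fun y => (m' + V / (m - m') / 2 * 1) + 1 / (2 * (V / (m - m'))) * H y ^ 2)
    (fun y => le_add_indicator_add_sq hm' hα)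
    (fun y _ => (le_add_indicator_add_sq hm' hα).trans (by
      gcongr
      split_ifs <;> norm_num)) T x
  rw [killedMean_add, killedMean_add, killedMean_const, killedMean_const_mul,
    killedMean_const_mul, ← hp] at h3
  have h4 : 1 / (2 * (V / (m - m'))) *
      killedMean G (fun y => F y ^ 2) (fun y => H y ^ 2) T x ≤ (m - m') / 2 := by
    calc _ ≤ 1 / (2 * (V / (m - m'))) * V := by gcongr
      _ = _ := by field_simp
  have h5 : (m - m') / 2 ≤ V / (m - m') / 2 * p := by linarith
  rw [div_le_iff₀ hV]
  have h6 : V / (m - m') / 2 * p = V * p / (2 * (m - m')) := by field_simp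
  rw [h6, le_div_iff₀ (by positivity)] at h5
  nlinarith

end Killed

/-! ### From the killed dynamics to the law of the process. -/

theorem rounds_real_succ [NeZero n] (T : ℕ) (x : Config n k) (A : Set (Config n k)) :
    (rounds (T + 1) x).toMeasure.real A =
      stepMean x fun y => (rounds T y).toMeasure.real A := by
  have hA : MeasurableSet A := A.toFinite.measurableSet
  simp only [MeasureTheory.measureReal_def, PMF.toMeasure_apply_eq_toOuterMeasure_apply _ hA]
  rw [rounds, round, PMF.bind_map, PMF.toOuterMeasure_bind_apply, tsum_fintype,
    ENNReal.toReal_sum]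
  · simp only [PMF.uniformOfFintype_apply, ENNReal.toReal_mul, Function.comp_apply, stepMean,
      ENNReal.toReal_inv, ENNReal.toReal_natCast, ← Finset.mul_sum]
    rw [div_eq_inv_mul]
  · intro s _
    refine ENNReal.mul_ne_top (PMF.apply_ne_top _ _) ?_
    rw [← PMF.toMeasure_apply_eq_toOuterMeasure_apply _ hA]
    exact MeasureTheory.measure_ne_top _ _

open Classical in
theorem killedMean_le_rounds_real [NeZero n] (G A : Set (Config n k)) (T : ℕ) (x : Config n k) :
    killedMean G (fun y => if y ∈ A then 1 else 0) (fun _ => 0) T x ≤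
      (rounds T x).toMeasure.real A := by
  refine killedMean_le_of_super G (h := fun t y => (rounds t y).toMeasure.real A)
    (fun y => ?_) (fun _ _ _ _ => MeasureTheory.measureReal_nonneg)
    (fun t _ y _ => (rounds_real_succ t y A).ge) T le_rfl x
  have hA : MeasurableSet A := A.toFinite.measurableSet
  simp only [MeasureTheory.measureReal_def, rounds]
  rw [PMF.toMeasure_pure_apply _ _ hA]
  split_ifs <;> simp

/-! ### The law of one round, node by node. -/

/-- The probability `∑ l, p_l ^ 2` that the two nodes pulled by a given node agree. -/
noncomputable def agreement (x : Config n k) : ℝ := ∑ l, frac x l ^ 2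

/-- The law of the opinion of the node `v` after one round started from `x`. -/
noncomputable def newLaw (x : Config n k) (v : Fin n) (l : Fin k) : ℝ :=
  frac x l ^ 2 + if l = x v then 1 - agreement x else 0

theorem frac_nonneg (x : Config n k) (l : Fin k) : 0 ≤ frac x l := by
  unfold frac
  positivity

theorem natCast_mul_frac [NeZero n] (x : Config n k) (l : Fin k) :
    (n : ℝ) * frac x l = ∑ v, if x v = l then 1 else 0 := by
  have : (n : ℝ) ≠ 0 := NeZero.ne _
  rw [frac, mul_div_cancel₀ _ this, Finset.sum_boole]

theorem sum_comp_eq [NeZero n] (x : Config n k) (f : Fin k → ℝ) :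
    ∑ v, f (x v) = n * ∑ l, frac x l * f l := by
  simp only [Finset.mul_sum, ← mul_assoc, natCast_mul_frac, Finset.sum_mul]
  rw [Finset.sum_comm]
  refine Finset.sum_congr rfl fun v _ => ?_
  simp

theorem sum_frac [NeZero n] (x : Config n k) : ∑ l, frac x l = 1 := by
  have h := sum_comp_eq x fun _ => 1
  have hn : (n : ℝ) ≠ 0 := NeZero.ne _
  simpa [hn] using h

theorem frac_le_one [NeZero n] (x : Config n k) (l : Fin k) : frac x l ≤ 1 := by
  rw [← sum_frac x]
  exact Finset.single_le_sum (fun l _ => frac_nonneg x l) (Finset.mem_univ l)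

theorem agreement_nonneg (x : Config n k) : 0 ≤ agreement x :=
  Finset.sum_nonneg fun _ _ => sq_nonneg _

theorem agreement_le [NeZero n] {x : Config n k} {β : ℝ} (h : ∀ l, frac x l ≤ β) :
    agreement x ≤ β := by
  calc agreement x ≤ ∑ l, β * frac x l := by
        refine Finset.sum_le_sum fun l _ => ?_
        rw [sq]
        exact mul_le_mul_of_nonneg_right (h l) (frac_nonneg x l)
    _ = β := by rw [← Finset.mul_sum, sum_frac, mul_one]

theorem agreement_le_one [NeZero n] (x : Config n k) : agreement x ≤ 1 :=
  agreement_le (frac_le_one x)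

theorem sum_newLaw_mul (x : Config n k) (v : Fin n) (f : Fin k → ℝ) :
    ∑ l, newLaw x v l * f l = f (x v) + ∑ l, frac x l ^ 2 * (f l - f (x v)) := by
  simp only [newLaw, add_mul, ite_mul, zero_mul, Finset.sum_add_distrib, Finset.sum_ite_eq',
    Finset.mem_univ, if_true, mul_sub, Finset.sum_sub_distrib,
    ← Finset.sum_mul, agreement]
  ring

theorem newLaw_nonneg [NeZero n] (x : Config n k) (v : Fin n) (l : Fin k) :
    0 ≤ newLaw x v l := by
  have := agreement_le_one x
  unfold newLaw
  split_ifs <;> nlinarith [sq_nonneg (frac x l)]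

theorem sum_newLaw (x : Config n k) (v : Fin n) : ∑ l, newLaw x v l = 1 := by
  simpa using sum_newLaw_mul x v fun _ => 1

theorem sum_pull [NeZero n] (x : Config n k) (v : Fin n) (f : Fin k → ℝ) :
    (∑ q : Fin n × Fin n, f (if x q.1 = x q.2 then x q.1 else x v)) / ((n : ℝ) * n) =
      ∑ l, newLaw x v l * f l := by
  have hn : (n : ℝ) ≠ 0 := NeZero.ne _
  have h1 : ∀ q : Fin n × Fin n, f (if x q.1 = x q.2 then x q.1 else x v) =
      f (x v) + ∑ l, ((if x q.1 = l then 1 else 0) * (if x q.2 = l then 1 else 0)) *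
        (f l - f (x v)) := by
    intro q
    rw [Finset.sum_eq_single (x q.1)]
    · by_cases h : x q.1 = x q.2
      · simp [h]
      · simp [h, Ne.symm h]
    · intro l _ hl
      simp [hl.symm]
    · simp
  have h2 : ∀ l, ∑ q : Fin n × Fin n, ((if x q.1 = l then (1 : ℝ) else 0) *
      (if x q.2 = l then 1 else 0)) = n * frac x l * (n * frac x l) := by
    intro l
    rw [natCast_mul_frac, Finset.sum_mul_sum, Fintype.sum_prod_type]
  rw [sum_newLaw_mul, Finset.sum_congr rfl fun q _ => h1 q, Finset.sum_add_distrib,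
    Finset.sum_comm]
  simp only [← Finset.sum_mul, h2, Finset.sum_const, Finset.card_univ, Fintype.card_prod,
    Fintype.card_fin, nsmul_eq_mul, Nat.cast_mul]
  rw [add_div, Finset.sum_div]
  congr 1
  · field_simp
  · refine Finset.sum_congr rfl fun l _ => ?_
    field_simp

/-- Independence of the nodes within a round; it is what makes exponential moments computable. -/
theorem stepMean_prod [NeZero n] (x : Config n k) (f : Fin k → ℝ) :
    stepMean x (fun y => ∏ v, f (y v)) = ∏ v, ∑ l, newLaw x v l * f l := by
  simp only [← sum_pull, Finset.prod_div_distrib, Finset.prod_univ_sum, stepMean, update,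
    Fintype.piFinset_univ]
  simp

/-! ### Exponential moments of a bounded variable on a finite set -/

section Weights

variable {ι : Type*} [Fintype ι] {w φ : ι → ℝ} {θ : ℝ}

/-- The mean of `φ` with respect to the weights `w`. -/
noncomputable def wMean (w φ : ι → ℝ) : ℝ := ∑ l, w l * φ l

/-- The variance of `φ` with respect to the weights `w`. -/
noncomputable def wVar (w φ : ι → ℝ) : ℝ := ∑ l, w l * (φ l - wMean w φ) ^ 2

theorem wVar_nonneg (hw : ∀ l, 0 ≤ w l) : 0 ≤ wVar w φ :=
  Finset.sum_nonneg fun l _ => mul_nonneg (hw l) (sq_nonneg _)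

theorem wVar_le (h1 : ∑ l, w l = 1) (c : ℝ) : wVar w φ ≤ ∑ l, w l * (φ l - c) ^ 2 := by
  have h : ∑ l, w l * (φ l - c) ^ 2 = wVar w φ + (wMean w φ - c) ^ 2 := by
    have : ∀ l, w l * (φ l - c) ^ 2 = w l * (φ l - wMean w φ) ^ 2 +
        2 * (wMean w φ - c) * (w l * φ l) + (c ^ 2 - wMean w φ ^ 2) * w l := fun l => by ring
    simp only [this, Finset.sum_add_distrib, ← Finset.mul_sum, h1]
    rw [show ∑ l, w l * φ l = wMean w φ from rfl,
      show ∑ l, w l * (φ l - wMean w φ) ^ 2 = wVar w φ from rfl]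
    ring
  rw [h]
  nlinarith [sq_nonneg (wMean w φ - c)]

theorem abs_sub_wMean_le (hw : ∀ l, 0 ≤ w l) (h1 : ∑ l, w l = 1) (hφ : ∀ l, |φ l| ≤ 1) (l : ι) :
    |φ l - wMean w φ| ≤ 2 := by
  have h : |wMean w φ| ≤ 1 := by
    calc |wMean w φ| ≤ ∑ l, |w l * φ l| := Finset.abs_sum_le_sum_abs _ _
      _ ≤ ∑ l, w l := Finset.sum_le_sum fun l _ => by
          rw [abs_mul, abs_of_nonneg (hw l)]
          exact mul_le_of_le_one_right (hw l) (hφ l)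
      _ = 1 := h1
  calc |φ l - wMean w φ| ≤ |φ l| + |wMean w φ| := abs_sub _ _
    _ ≤ 2 := by linarith [hφ l]

theorem one_add_add_sq_div_four_le_exp {y : ℝ} (hy : |y| ≤ 1) :
    1 + y + y ^ 2 / 4 ≤ Real.exp y := by
  have h := (abs_le.1 (Real.exp_bound hy (n := 3) (by norm_num))).1
  simp only [Finset.sum_range_succ, Finset.sum_range_zero, Nat.factorial] at h
  have h3 : |y| ^ 3 ≤ y ^ 2 := by
    rw [← sq_abs]
    exact pow_le_pow_of_le_one (abs_nonneg y) hy (by norm_num)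
  norm_num at h
  nlinarith [sq_nonneg y]

theorem exp_half_le {z : ℝ} (h0 : 0 ≤ z) (h1 : z ≤ 1) : Real.exp (z / 2) ≤ 1 + z := by
  have h := (abs_le.1 (Real.abs_exp_sub_one_sub_id_le (x := z / 2)
    (abs_le.2 ⟨by linarith, by linarith⟩))).2
  nlinarith

theorem sum_mul_exp_eq (w φ : ι → ℝ) (θ : ℝ) :
    ∑ l, w l * Real.exp (θ * φ l) =
      Real.exp (θ * wMean w φ) * ∑ l, w l * Real.exp (θ * (φ l - wMean w φ)) := by
  rw [Finset.mul_sum]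
  refine Finset.sum_congr rfl fun l _ => ?_
  rw [mul_left_comm, ← Real.exp_add]
  ring_nf

theorem sum_mul_quadratic (h1 : ∑ l, w l = 1) (c : ℝ) :
    ∑ l, w l * (1 + θ * (φ l - wMean w φ) + (θ * (φ l - wMean w φ)) ^ 2 * c) =
      1 + θ ^ 2 * wVar w φ * c := by
  have : ∀ l, w l * (1 + θ * (φ l - wMean w φ) + (θ * (φ l - wMean w φ)) ^ 2 * c) =
      (1 - θ * wMean w φ) * w l + θ * (w l * φ l) +
        θ ^ 2 * c * (w l * (φ l - wMean w φ) ^ 2) := fun l => by ring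
  simp only [this, Finset.sum_add_distrib, ← Finset.mul_sum, h1]
  rw [show ∑ l, w l * φ l = wMean w φ from rfl,
    show ∑ l, w l * (φ l - wMean w φ) ^ 2 = wVar w φ from rfl]
  ring

theorem sum_mul_exp_le (hw : ∀ l, 0 ≤ w l) (h1 : ∑ l, w l = 1) (hφ : ∀ l, |φ l| ≤ 1)
    (hθ : |θ| ≤ 1 / 2) :
    ∑ l, w l * Real.exp (θ * φ l) ≤ Real.exp (θ * wMean w φ + θ ^ 2 * wVar w φ) := by
  rw [sum_mul_exp_eq, Real.exp_add]
  gcongr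
  calc _ ≤ ∑ l, w l * (1 + θ * (φ l - wMean w φ) + (θ * (φ l - wMean w φ)) ^ 2 * 1) := by
        refine Finset.sum_le_sum fun l _ => mul_le_mul_of_nonneg_left ?_ (hw l)
        -- Deviations from the mean are at most `2` and `|θ| ≤ 1/2`, so quadratic bounds on `exp`
        -- over `[-1, 1]` apply.
        have hy : |θ * (φ l - wMean w φ)| ≤ 1 := by
          rw [abs_mul]
          nlinarith [abs_sub_wMean_le hw h1 hφ l, abs_nonneg θ, abs_nonneg (φ l - wMean w φ)]
        linarith [(abs_le.1 (Real.abs_exp_sub_one_sub_id_le hy)).2]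
    _ ≤ _ := by
        rw [sum_mul_quadratic h1]
        linarith [Real.add_one_le_exp (θ ^ 2 * wVar w φ)]

theorem le_sum_mul_exp (hw : ∀ l, 0 ≤ w l) (h1 : ∑ l, w l = 1) (hφ : ∀ l, |φ l| ≤ 1)
    (hθ : |θ| ≤ 1 / 2) :
    Real.exp (θ * wMean w φ + θ ^ 2 * wVar w φ / 8) ≤ ∑ l, w l * Real.exp (θ * φ l) := by
  have hy : ∀ l, |θ * (φ l - wMean w φ)| ≤ 1 := fun l => by
    rw [abs_mul]
    nlinarith [abs_sub_wMean_le hw h1 hφ l, abs_nonneg θ, abs_nonneg (φ l - wMean w φ)]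
  rw [sum_mul_exp_eq, Real.exp_add]
  gcongr
  have hV := wVar_nonneg (φ := φ) hw
  have hz : θ ^ 2 * wVar w φ ≤ 1 := by
    calc θ ^ 2 * wVar w φ = ∑ l, w l * (θ * (φ l - wMean w φ)) ^ 2 := by
          rw [wVar, Finset.mul_sum]
          exact Finset.sum_congr rfl fun l _ => by ring
      _ ≤ ∑ l, w l := Finset.sum_le_sum fun l _ =>
          mul_le_of_le_one_right (hw l) ((sq_le_one_iff_abs_le_one _).2 (hy l))
      _ = 1 := h1
  calc Real.exp (θ ^ 2 * wVar w φ / 8) = Real.exp (θ ^ 2 * wVar w φ * (1 / 4) / 2) := by ring_nf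
    _ ≤ 1 + θ ^ 2 * wVar w φ * (1 / 4) := exp_half_le (by positivity) (by linarith)
    _ = ∑ l, w l * (1 + θ * (φ l - wMean w φ) + (θ * (φ l - wMean w φ)) ^ 2 * (1 / 4)) :=
        (sum_mul_quadratic h1 _).symm
    _ ≤ _ := by
        refine Finset.sum_le_sum fun l _ => mul_le_mul_of_nonneg_left ?_ (hw l)
        linarith [one_add_add_sq_div_four_le_exp (hy l)]

/-- The mean cannot be within less than `1/2` of both `φ a` and `φ b`, so one of these two points
alone contributes enough. -/
theorem le_wVar (hw : ∀ l, 0 ≤ w l) {a b : ι} (hab : φ b + 1 ≤ φ a) {p : ℝ} (hp0 : 0 ≤ p)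
    (hp1 : p ≤ 1) (ha : p ≤ w a) (hb : 1 / 4 ≤ w b) : p / 16 ≤ wVar w φ := by
  have key : ∀ l, w l * (φ l - wMean w φ) ^ 2 ≤ wVar w φ := fun l =>
    Finset.single_le_sum (f := fun l => w l * (φ l - wMean w φ) ^ 2)
      (fun l _ => mul_nonneg (hw l) (sq_nonneg _)) (Finset.mem_univ l)
  rcases le_total (wMean w φ + 1 / 2) (φ a) with h | h
  · refine le_trans ?_ (key a)
    have : 1 / 4 ≤ (φ a - wMean w φ) ^ 2 := by nlinarith
    nlinarith
  · refine le_trans ?_ (key b)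
    have : 1 / 4 ≤ (φ b - wMean w φ) ^ 2 := by nlinarith
    nlinarith

end Weights

/-! ### The difference of two opinions -/

/-- The contribution of a node to the difference between the opinions `i` and `j`. -/
def sign (i j l : Fin k) : ℝ := (if l = i then 1 else 0) - if l = j then 1 else 0

/-- The number of nodes with opinion `i` minus the number of nodes with opinion `j`. -/
noncomputable def diff (x : Config n k) (i j : Fin k) : ℝ := n * (frac x i - frac x j)

variable {i j : Fin k}

theorem abs_sign_le (l : Fin k) : |sign i j l| ≤ 1 := by
  unfold sign
  split_ifs <;> norm_num

theorem sum_sign [NeZero n] (x : Config n k) : ∑ v, sign i j (x v) = diff x i j := by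
  simp only [sign, Finset.sum_sub_distrib, diff, mul_sub, natCast_mul_frac]

theorem sum_wMean_sign [NeZero n] (x : Config n k) :
    ∑ v, wMean (newLaw x v) (sign i j) =
      (1 + (frac x i + frac x j - agreement x)) * diff x i j := by
  have h : ∀ v, wMean (newLaw x v) (sign i j) =
      (1 - agreement x) * sign i j (x v) + (frac x i ^ 2 - frac x j ^ 2) := by
    intro v
    rw [wMean, sum_newLaw_mul]
    simp only [mul_sub, Finset.sum_sub_distrib, ← Finset.sum_mul]
    rw [← agreement]
    simp only [sign, mul_sub, mul_ite, mul_one, mul_zero, Finset.sum_sub_distrib,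
      Finset.sum_ite_eq', Finset.mem_univ, if_true]
    split_ifs <;> ring
  simp only [h, Finset.sum_add_distrib, ← Finset.mul_sum, sum_sign, Finset.sum_const,
    Finset.card_univ, Fintype.card_fin, nsmul_eq_mul, diff]
  ring

/-- The variance is at most the mean square change from the node's current sign. By `(a - b)² ≤ 2a²
+ 2b²` it is paid either by pulling `i` or `j` twice, or by an agreeing pull at a node that holds
one of them. -/
theorem sum_wVar_sign_le [NeZero n] {x : Config n k} (hij : i ≠ j) {β : ℝ}
    (h : ∀ l, frac x l ≤ β) :
    ∑ v, wVar (newLaw x v) (sign i j) ≤ 8 * n * β ^ 2 := by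
  have hsq : ∀ l, sign i j l ^ 2 = (if l = i then 1 else 0) + if l = j then 1 else 0 := by
    intro l
    unfold sign
    split_ifs with h1 h2 <;> first | exact absurd (h1.symm.trans h2) hij | norm_num
  have hv : ∀ v, wVar (newLaw x v) (sign i j) ≤
      2 * (frac x i ^ 2 + frac x j ^ 2) + 2 * agreement x * sign i j (x v) ^ 2 := by
    intro v
    refine (wVar_le (sum_newLaw x v) (sign i j (x v))).trans ?_
    rw [sum_newLaw_mul x v fun l => (sign i j l - sign i j (x v)) ^ 2]
    have h2 : ∀ l, frac x l ^ 2 *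
        ((sign i j l - sign i j (x v)) ^ 2 - (sign i j (x v) - sign i j (x v)) ^ 2) ≤
        2 * (frac x l ^ 2 * sign i j l ^ 2) + 2 * sign i j (x v) ^ 2 * frac x l ^ 2 := by
      intro l
      nlinarith [mul_nonneg (sq_nonneg (frac x l)) (sq_nonneg (sign i j l + sign i j (x v)))]
    refine (add_le_add_right (Finset.sum_le_sum fun l _ => h2 l) _).trans (le_of_eq ?_)
    rw [Finset.sum_add_distrib, ← Finset.mul_sum, ← Finset.mul_sum, ← agreement]
    simp only [hsq, mul_add, mul_ite, mul_one, mul_zero, Finset.sum_add_distrib,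
      Finset.sum_ite_eq', Finset.mem_univ, if_true]
    split_ifs <;> ring
  have hn : (0 : ℝ) ≤ n := Nat.cast_nonneg _
  have hi := frac_nonneg x i
  have hj := frac_nonneg x j
  have hS := agreement_le h
  have hS0 := agreement_nonneg x
  have hi2 : frac x i ^ 2 ≤ β ^ 2 := pow_le_pow_left₀ hi (h i) 2
  have hj2 : frac x j ^ 2 ≤ β ^ 2 := pow_le_pow_left₀ hj (h j) 2
  have h3 : agreement x * (frac x i + frac x j) ≤ β * (β + β) :=
    mul_le_mul hS (add_le_add (h i) (h j)) (by positivity) (hS0.trans hS)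
  calc _ ≤ ∑ v, (2 * (frac x i ^ 2 + frac x j ^ 2) + 2 * agreement x * sign i j (x v) ^ 2) :=
        Finset.sum_le_sum fun v _ => hv v
    _ = n * (2 * (frac x i ^ 2 + frac x j ^ 2) +
          2 * (agreement x * (frac x i + frac x j))) := by
        simp only [Finset.sum_add_distrib, ← Finset.mul_sum, hsq, ← natCast_mul_frac,
          Finset.sum_const, Finset.card_univ, Fintype.card_fin, nsmul_eq_mul]
        ring
    _ ≤ n * (8 * β ^ 2) := by
        gcongr
        nlinarith
    _ = _ := by ring

/-- A node not holding `i` switches to `i` with probability `p_i²` and keeps its opinion with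
probability at least `1/4`; the two outcomes differ by at least `1` in sign. At least a quarter of
the nodes are of this kind. -/
theorem le_sum_wVar_sign [NeZero n] {x : Config n k} (hij : i ≠ j)
    (hi : frac x i ≤ 3 / 4) (hS : agreement x ≤ 3 / 4) :
    n * frac x i ^ 2 / 64 ≤ ∑ v, wVar (newLaw x v) (sign i j) := by
  have hi0 := frac_nonneg x i
  have hv : ∀ v, (1 - if x v = i then 1 else 0) * (frac x i ^ 2 / 16) ≤
      wVar (newLaw x v) (sign i j) := by
    intro v
    split_ifs with h
    · simpa using wVar_nonneg (newLaw_nonneg x v)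
    · rw [sub_zero, one_mul]
      refine le_wVar (newLaw_nonneg x v) (a := i) (b := x v) ?_ (sq_nonneg _) ?_ ?_ ?_
      · simp only [sign, h, if_false, if_true, hij]
        split_ifs <;> norm_num
      · nlinarith
      · simp only [newLaw, Ne.symm h, if_false]
        linarith
      · simp only [newLaw, if_true]
        nlinarith [sq_nonneg (frac x (x v))]
  refine le_trans ?_ (Finset.sum_le_sum fun v _ => hv v)
  rw [← Finset.sum_mul, Finset.sum_sub_distrib, ← natCast_mul_frac]
  simp only [Finset.sum_const, Finset.card_univ, Fintype.card_fin, nsmul_eq_mul, mul_one]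
  have hn : (0 : ℝ) ≤ n := Nat.cast_nonneg _
  nlinarith [mul_nonneg hn (sq_nonneg (frac x i)),
    mul_nonneg (mul_nonneg hn (sq_nonneg (frac x i))) (sub_nonneg.2 hi)]

theorem exp_mul_diff [NeZero n] (y : Config n k) (θ : ℝ) :
    Real.exp (θ * diff y i j) = ∏ v, Real.exp (θ * sign i j (y v)) := by
  rw [← Real.exp_sum, ← Finset.mul_sum, sum_sign]

theorem stepMean_exp_diff_le [NeZero n] {x : Config n k} (hij : i ≠ j) {β θ : ℝ}
    (h : ∀ l, frac x l ≤ β) (hθ : |θ| ≤ 1 / 2) :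
    stepMean x (fun y => Real.exp (θ * diff y i j)) ≤
      Real.exp (θ * ((1 + (frac x i + frac x j - agreement x)) * diff x i j)) *
        Real.exp (θ ^ 2 * (8 * n * β ^ 2)) := by
  simp only [exp_mul_diff]
  rw [stepMean_prod x fun l => Real.exp (θ * sign i j l), ← Real.exp_add]
  calc _ ≤ ∏ v, Real.exp (θ * wMean (newLaw x v) (sign i j) +
        θ ^ 2 * wVar (newLaw x v) (sign i j)) :=
        Finset.prod_le_prod
          (fun v _ => Finset.sum_nonneg fun l _ =>
            mul_nonneg (newLaw_nonneg x v l) (Real.exp_pos _).le)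
          fun v _ => sum_mul_exp_le (newLaw_nonneg x v) (sum_newLaw x v) abs_sign_le hθ
    _ ≤ _ := by
        rw [← Real.exp_sum, Finset.sum_add_distrib, ← Finset.mul_sum, ← Finset.mul_sum,
          sum_wMean_sign]
        gcongr
        exact sum_wVar_sign_le hij h

theorem le_stepMean_exp_diff [NeZero n] {x : Config n k} (hij : i ≠ j) {p θ : ℝ} (hp : 0 ≤ p)
    (hip : p ≤ frac x i) (hi : frac x i ≤ 3 / 4) (hS : agreement x ≤ 3 / 4) (hθ : |θ| ≤ 1 / 2) :
    Real.exp (θ * ((1 + (frac x i + frac x j - agreement x)) * diff x i j)) *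
        Real.exp (θ ^ 2 * (n * p ^ 2 / 512)) ≤
      stepMean x (fun y => Real.exp (θ * diff y i j)) := by
  simp only [exp_mul_diff]
  rw [stepMean_prod x fun l => Real.exp (θ * sign i j l), ← Real.exp_add]
  calc _ ≤ ∏ v, Real.exp (θ * wMean (newLaw x v) (sign i j) +
        θ ^ 2 * wVar (newLaw x v) (sign i j) / 8) := by
        rw [← Real.exp_sum, Finset.sum_add_distrib, ← Finset.mul_sum, ← Finset.sum_div,
          ← Finset.mul_sum, sum_wMean_sign]
        have h1 : n * p ^ 2 / 64 ≤ ∑ v, wVar (newLaw x v) (sign i j) :=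
          le_trans (by gcongr) (le_sum_wVar_sign hij hi hS)
        have h2 := mul_le_mul_of_nonneg_left h1 (sq_nonneg θ)
        gcongr
        linarith
    _ ≤ _ := Finset.prod_le_prod (fun v _ => (Real.exp_pos _).le)
          fun v _ => le_sum_mul_exp (newLaw_nonneg x v) (sum_newLaw x v) abs_sign_le hθ

theorem stepMean_cosh_eq (x : Config n k) (θ : ℝ) :
    stepMean x (fun y => Real.cosh (θ * diff y i j)) =
      (stepMean x (fun y => Real.exp (θ * diff y i j)) +
        stepMean x (fun y => Real.exp (-θ * diff y i j))) / 2 := by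
  rw [← stepMean_add, div_eq_inv_mul, ← stepMean_const_mul]
  congr 1
  funext y
  rw [Real.cosh_eq]
  ring_nf

theorem stepMean_cosh_diff_le [NeZero n] {x : Config n k} (hij : i ≠ j) {β θ : ℝ}
    (h : ∀ l, frac x l ≤ β) (hθ : |θ| ≤ 1 / 2) :
    stepMean x (fun y => Real.cosh (θ * diff y i j)) ≤
      Real.exp (θ ^ 2 * (8 * n * β ^ 2)) * Real.cosh (θ * (1 + 2 * β) * diff x i j) := by
  have h1 := stepMean_exp_diff_le hij h hθ
  have h2 := stepMean_exp_diff_le hij h (θ := -θ) (by rwa [abs_neg])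
  rw [neg_sq] at h2
  have hr : |1 + (frac x i + frac x j - agreement x)| ≤ |1 + 2 * β| := by
    have := agreement_le_one x
    have := agreement_nonneg x
    have := frac_nonneg x i
    have := frac_nonneg x j
    have := h i
    have := h j
    rw [abs_of_nonneg (by linarith), abs_of_nonneg (by linarith)]
    linarith
  calc _ ≤ Real.exp (θ ^ 2 * (8 * n * β ^ 2)) *
        Real.cosh (θ * ((1 + (frac x i + frac x j - agreement x)) * diff x i j)) := by
        rw [stepMean_cosh_eq, Real.cosh_eq, ← neg_mul]
        linarith
    _ ≤ _ := by
        gcongr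
        rw [Real.cosh_le_cosh]
        simp only [abs_mul, mul_assoc]
        gcongr

theorem le_stepMean_cosh_diff [NeZero n] {x : Config n k} (hij : i ≠ j) {p β θ : ℝ} (hp : 0 ≤ p)
    (hip : p ≤ frac x i) (h : ∀ l, frac x l ≤ β) (hβ : β ≤ 3 / 4) (hθ : |θ| ≤ 1 / 2) :
    Real.exp (θ ^ 2 * (n * p ^ 2 / 512)) * Real.cosh (θ * (1 - β) * diff x i j) ≤
      stepMean x (fun y => Real.cosh (θ * diff y i j)) := by
  have hS := agreement_le h
  have h1 := le_stepMean_exp_diff hij hp hip ((h i).trans hβ) (hS.trans hβ) hθ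
  have h2 := le_stepMean_exp_diff hij hp hip ((h i).trans hβ) (hS.trans hβ) (θ := -θ)
    (by rwa [abs_neg])
  rw [neg_sq] at h2
  have hr : |1 - β| ≤ |1 + (frac x i + frac x j - agreement x)| := by
    have := frac_nonneg x i
    have := frac_nonneg x j
    rw [abs_of_nonneg (by linarith), abs_of_nonneg (by linarith)]
    linarith
  calc _ ≤ Real.exp (θ ^ 2 * (n * p ^ 2 / 512)) *
        Real.cosh (θ * ((1 + (frac x i + frac x j - agreement x)) * diff x i j)) := by
        gcongr
        rw [Real.cosh_le_cosh]
        simp only [abs_mul, mul_assoc]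
        gcongr
    _ ≤ _ := by
        rw [stepMean_cosh_eq, Real.cosh_eq, ← neg_mul]
        linarith

/-! ### The size of a single opinion -/

theorem exp_mul_frac [NeZero n] (y : Config n k) (l : Fin k) (μ : ℝ) :
    Real.exp (μ * (n * frac y l)) = ∏ v, Real.exp (μ * if y v = l then 1 else 0) := by
  rw [← Real.exp_sum, ← Finset.mul_sum, natCast_mul_frac]

theorem exp_sub_one_le {μ : ℝ} (h0 : 0 ≤ μ) (h1 : μ ≤ 1) : Real.exp μ - 1 ≤ μ * (1 + μ) := by
  have := (abs_le.1 (Real.abs_exp_sub_one_sub_id_le (abs_le.2 ⟨by linarith, h1⟩))).2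
  linarith

/-- Departures from `l` only help and are ignored; each other node joins with probability `p_l²`,
for at most `n p_l² ≤ β n p_l` expected arrivals. -/
theorem stepMean_exp_frac_le [NeZero n] {x : Config n k} {β μ : ℝ} (l : Fin k)
    (h : frac x l ≤ β) (hμ0 : 0 ≤ μ) (hμ1 : μ ≤ 1) :
    stepMean x (fun y => Real.exp (μ * (n * frac y l))) ≤
      Real.exp (μ * (1 + 2 * β) * (n * frac x l)) := by
  simp only [exp_mul_frac _ _ μ]
  rw [stepMean_prod x fun m => Real.exp (μ * if m = l then 1 else 0)]
  have hl := frac_nonneg x l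
  have hv : ∀ v, ∑ m, newLaw x v m * Real.exp (μ * if m = l then 1 else 0) ≤
      Real.exp (μ * (if x v = l then 1 else 0) + 2 * μ * frac x l ^ 2) := by
    intro v
    have he : 1 ≤ Real.exp μ := Real.one_le_exp hμ0
    rw [sum_newLaw_mul x v fun m => Real.exp (μ * if m = l then 1 else 0)]
    by_cases hx : x v = l
    · have : ∑ m, frac x m ^ 2 * (Real.exp (μ * if m = l then 1 else 0) -
          Real.exp (μ * if x v = l then 1 else 0)) ≤ 0 := by
        refine Finset.sum_nonpos fun m _ => mul_nonpos_of_nonneg_of_nonpos (sq_nonneg _) ?_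
        rw [if_pos hx]
        split_ifs
        · simp
        · simpa using he
      have h2 : Real.exp (μ * if x v = l then 1 else 0) ≤
          Real.exp (μ * (if x v = l then 1 else 0) + 2 * μ * frac x l ^ 2) := by
        gcongr
        have : 0 ≤ 2 * μ * frac x l ^ 2 := by positivity
        linarith
      linarith
    · have : ∀ m, frac x m ^ 2 * (Real.exp (μ * if m = l then 1 else 0) -
          Real.exp (μ * if x v = l then 1 else 0)) =
          if m = l then frac x m ^ 2 * (Real.exp μ - 1) else 0 := by
        intro m
        rw [if_neg hx]
        split_ifs <;> simp
      rw [Finset.sum_congr rfl fun m _ => this m]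
      simp only [Finset.sum_ite_eq', Finset.mem_univ, if_true, if_neg hx, mul_zero, zero_add,
        Real.exp_zero]
      have h3 := exp_sub_one_le hμ0 hμ1
      have h4 := Real.add_one_le_exp (2 * μ * frac x l ^ 2)
      have h5 : frac x l ^ 2 * (Real.exp μ - 1) ≤ frac x l ^ 2 * (2 * μ) := by
        gcongr
        nlinarith
      linarith
  refine (Finset.prod_le_prod (fun v _ => Finset.sum_nonneg fun m _ =>
    mul_nonneg (newLaw_nonneg x v m) (Real.exp_pos _).le) fun v _ => hv v).trans ?_
  rw [← Real.exp_sum, Finset.sum_add_distrib, ← Finset.mul_sum, ← natCast_mul_frac]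
  simp only [Finset.sum_const, Finset.card_univ, Fintype.card_fin, nsmul_eq_mul]
  gcongr
  have hn : (0 : ℝ) ≤ n := Nat.cast_nonneg _
  nlinarith [mul_nonneg (mul_nonneg (mul_nonneg hμ0 hn) hl) (sub_nonneg.2 h)]

/-- Arrivals at `l` are ignored; a holder of `l` leaves with probability at most `agreement x ≤ β`.
-/
theorem stepMean_exp_neg_frac_le [NeZero n] {x : Config n k} {β μ : ℝ} (l : Fin k)
    (h : ∀ l, frac x l ≤ β) (hμ0 : 0 ≤ μ) (hμ1 : μ ≤ 1) :
    stepMean x (fun y => Real.exp (-μ * (n * frac y l))) ≤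
      Real.exp (-(μ * (1 - β * (1 + μ))) * (n * frac x l)) := by
  simp only [exp_mul_frac _ _ (-μ), exp_mul_frac _ _ (-(μ * (1 - β * (1 + μ))))]
  rw [stepMean_prod x fun m => Real.exp (-μ * if m = l then 1 else 0)]
  refine Finset.prod_le_prod (fun v _ => Finset.sum_nonneg fun m _ =>
    mul_nonneg (newLaw_nonneg x v m) (Real.exp_pos _).le) fun v _ => ?_
  have he : Real.exp (-μ) ≤ 1 := Real.exp_le_one_iff.2 (by linarith)
  have hle : ∀ m, Real.exp (-μ * if m = l then 1 else 0) ≤ 1 := fun m => by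
    split_ifs
    · simpa using he
    · simp
  by_cases hx : x v = l
  · rw [sum_newLaw_mul x v fun m => Real.exp (-μ * if m = l then 1 else 0)]
    have h1 : ∑ m, frac x m ^ 2 * (Real.exp (-μ * if m = l then 1 else 0) -
        Real.exp (-μ * if x v = l then 1 else 0)) ≤ agreement x * (1 - Real.exp (-μ)) := by
      rw [agreement, Finset.sum_mul]
      refine Finset.sum_le_sum fun m _ => ?_
      rw [if_pos hx, mul_one]
      gcongr
      exact hle m
    have h2 : agreement x * (1 - Real.exp (-μ)) ≤ β * (1 - Real.exp (-μ)) :=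
      mul_le_mul_of_nonneg_right (agreement_le h) (by linarith)
    have hβ : 0 ≤ β := (frac_nonneg x l).trans (h l)
    rw [if_pos hx, mul_one] at *
    have h3 : Real.exp (-μ) + β * (1 - Real.exp (-μ)) =
        Real.exp (-μ) * (1 + β * (Real.exp μ - 1)) := by
      have : Real.exp (-μ) * Real.exp μ = 1 := by rw [← Real.exp_add]; simp
      linear_combination (-β) * this
    have h4 : 1 + β * (Real.exp μ - 1) ≤ Real.exp (β * (μ * (1 + μ))) := by
      have := mul_le_mul_of_nonneg_left (exp_sub_one_le hμ0 hμ1) hβ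
      linarith [Real.add_one_le_exp (β * (μ * (1 + μ)))]
    calc _ ≤ Real.exp (-μ) * (1 + β * (Real.exp μ - 1)) := by rw [← h3]; linarith
      _ ≤ Real.exp (-μ) * Real.exp (β * (μ * (1 + μ))) := by gcongr
      _ = _ := by rw [← Real.exp_add]; ring_nf
  · rw [if_neg hx, mul_zero, Real.exp_zero]
    exact (Finset.sum_le_sum fun m _ =>
      mul_le_of_le_one_right (newLaw_nonneg x v m) (hle m)).trans (sum_newLaw x v).le

/-! ### Exponential moments over a whole phase. -/

/-- The configurations in which no fraction exceeds `β` and those of `i` and `j` are at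
least `p`. -/
def goodSet (n : ℕ) (i j : Fin k) (β p : ℝ) : Set (Config n k) :=
  {x | (∀ l, frac x l ≤ β) ∧ p ≤ frac x i ∧ p ≤ frac x j}

theorem cosh_mul_le_cosh_mul {a b : ℝ} (ha : 0 ≤ a) (hab : a ≤ b) (d : ℝ) :
    Real.cosh (a * d) ≤ Real.cosh (b * d) := by
  rw [Real.cosh_le_cosh, abs_mul, abs_mul, abs_of_nonneg ha, abs_of_nonneg (ha.trans hab)]
  gcongr

theorem quarter_le_one_sub_pow {β : ℝ} {T t : ℕ} (hβ0 : 0 ≤ β) (hβ1 : β ≤ 3 / 4)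
    (hβ : β * T ≤ 3 / 4) (ht : t ≤ T) : 1 / 4 ≤ (1 - β) ^ t := by
  have h := one_add_mul_le_pow (a := -β) (by linarith) t
  have ht' : (t : ℝ) ≤ T := by exact_mod_cast ht
  have := mul_le_mul_of_nonneg_left ht' hβ0
  rw [sub_eq_add_neg]
  linarith

theorem one_add_two_mul_pow_le {β : ℝ} {T t : ℕ} (hβ0 : 0 ≤ β)
    (hβ : β * T ≤ 3 / 4) (ht : t ≤ T) : (1 + 2 * β) ^ t ≤ 5 := by
  have ht' : (t : ℝ) ≤ T := by exact_mod_cast ht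
  have h1 := mul_le_mul_of_nonneg_left ht' hβ0
  have h2 : Real.exp (3 / 2) ≤ 5 := by
    have h3 : Real.exp (3 / 2) ^ 2 = Real.exp 1 ^ 3 := by
      rw [← Real.exp_nat_mul, ← Real.exp_nat_mul]
      norm_num
    have h4 : Real.exp 1 ^ 3 ≤ 2.72 ^ 3 :=
      pow_le_pow_left₀ (Real.exp_pos _).le (by linarith [Real.exp_one_lt_d9]) 3
    refine (sq_le_sq₀ (Real.exp_pos _).le (by norm_num)).1 ?_
    rw [h3]
    exact h4.trans (by norm_num)
  calc (1 + 2 * β) ^ t ≤ Real.exp (2 * β) ^ t :=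
        pow_le_pow_left₀ (by linarith) (by linarith [Real.add_one_le_exp (2 * β)]) t
    _ = Real.exp (t * (2 * β)) := (Real.exp_nat_mul _ _).symm
    _ ≤ Real.exp (3 / 2) := Real.exp_le_exp.2 (by linarith)
    _ ≤ 5 := h2

/-- The subsolution shrinks the exponent by `1 - β` per remaining round. The payoff at killing
carries the full factor for `T` rounds, so that it dominates whenever killing happens. -/
theorem le_killedMean_cosh [NeZero n] (hij : i ≠ j) {β p θ v : ℝ} {T : ℕ} (hp : 0 ≤ p)
    (hβ0 : 0 ≤ β) (hβ1 : β ≤ 3 / 4) (hβ : β * T ≤ 3 / 4) (hθ0 : 0 ≤ θ) (hθ : θ ≤ 1 / 2)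
    (hv : v = n * p ^ 2 / 8192) (x : Config n k) :
    Real.exp (T * (θ ^ 2 * v)) * Real.cosh (θ * (1 - β) ^ T * diff x i j) ≤
      killedMean (goodSet n i j β p) (fun y => Real.cosh (θ * diff y i j))
        (fun y => Real.exp (T * (θ ^ 2 * v)) * Real.cosh (θ * diff y i j)) T x := by
  have hv0 : 0 ≤ v := by rw [hv]; positivity
  have hpow1 : ∀ t : ℕ, (1 - β) ^ t ≤ 1 := fun t => pow_le_one₀ (by linarith) (by linarith)
  have hpow0 : ∀ t : ℕ, 0 ≤ (1 - β) ^ t := fun t => pow_nonneg (by linarith) t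
  refine le_killedMean_of_sub (goodSet n i j β p)
    (h := fun t y => Real.exp (t * (θ ^ 2 * v)) * Real.cosh (θ * (1 - β) ^ t * diff y i j))
    (fun y => ?_) (fun t ht y _ => ?_) (fun t ht y hy => ?_) T le_rfl x
  · simp
  · have ht' : ((t + 1 : ℕ) : ℝ) ≤ T := by exact_mod_cast ht
    have hc : Real.cosh (θ * (1 - β) ^ (t + 1) * diff y i j) ≤ Real.cosh (θ * diff y i j) :=
      cosh_mul_le_cosh_mul (mul_nonneg hθ0 (hpow0 _)) (mul_le_of_le_one_right hθ0 (hpow1 _)) _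
    gcongr
  · have hq := quarter_le_one_sub_pow hβ0 hβ1 hβ ht.le
    have h0 : 0 ≤ θ * (1 - β) ^ t := mul_nonneg hθ0 (hpow0 t)
    have h1 := le_stepMean_cosh_diff hij (θ := θ * (1 - β) ^ t) hp hy.2.1 hy.1 hβ1 (by
      rw [abs_of_nonneg h0]
      exact (mul_le_of_le_one_right hθ0 (hpow1 t)).trans hθ)
    -- The shrunken exponent is still at least `θ/4`; squaring loses `16`, and `8192 = 16 * 512`.
    have h2 : θ ^ 2 * v ≤ (θ * (1 - β) ^ t) ^ 2 * (n * p ^ 2 / 512) := by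
      have : (1 : ℝ) / 16 ≤ ((1 - β) ^ t) ^ 2 := by nlinarith
      calc θ ^ 2 * v = θ ^ 2 * (1 / 16) * (n * p ^ 2 / 512) := by rw [hv]; ring
        _ ≤ θ ^ 2 * ((1 - β) ^ t) ^ 2 * (n * p ^ 2 / 512) := by gcongr
        _ = _ := by ring
    rw [stepMean_const_mul]
    calc _ = Real.exp (t * (θ ^ 2 * v)) * (Real.exp (θ ^ 2 * v) *
          Real.cosh (θ * (1 - β) ^ t * (1 - β) * diff y i j)) := by
          rw [← mul_assoc (Real.exp _) (Real.exp _), ← Real.exp_add, pow_succ]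
          push_cast
          ring_nf
      _ ≤ Real.exp (t * (θ ^ 2 * v)) * (Real.exp ((θ * (1 - β) ^ t) ^ 2 * (n * p ^ 2 / 512)) *
          Real.cosh (θ * (1 - β) ^ t * (1 - β) * diff y i j)) := by gcongr
      _ ≤ _ := by gcongr

theorem killedMean_cosh_le [NeZero n] (hij : i ≠ j) {β p θ : ℝ} {T : ℕ}
    (hβ0 : 0 ≤ β) (hβ : β * T ≤ 3 / 4) (hθ0 : 0 ≤ θ) (hθ : θ ≤ 1 / 10) (x : Config n k) :
    killedMean (goodSet n i j β p) (fun y => Real.cosh (θ * diff y i j))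
        (fun y => Real.cosh (θ * diff y i j)) T x ≤
      Real.exp (T * ((5 * θ) ^ 2 * (8 * n * β ^ 2))) *
        Real.cosh (θ * (1 + 2 * β) ^ T * diff x i j) := by
  have hpow1 : ∀ t : ℕ, 1 ≤ (1 + 2 * β) ^ t := fun t => one_le_pow₀ (by linarith)
  refine killedMean_le_of_super (goodSet n i j β p)
    (h := fun t y => Real.exp (t * ((5 * θ) ^ 2 * (8 * n * β ^ 2))) *
      Real.cosh (θ * (1 + 2 * β) ^ t * diff y i j))
    (fun y => ?_) (fun t ht y _ => ?_) (fun t ht y hy => ?_) T le_rfl x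
  · simp
  · refine le_trans ?_ (le_mul_of_one_le_left (Real.cosh_pos _).le
      (Real.one_le_exp (by positivity)))
    exact cosh_mul_le_cosh_mul hθ0 (le_mul_of_one_le_right hθ0 (hpow1 _)) _
  · have h5 := one_add_two_mul_pow_le hβ0 hβ ht.le
    have h0 : 0 ≤ θ * (1 + 2 * β) ^ t := by positivity
    have hle : θ * (1 + 2 * β) ^ t ≤ 5 * θ := by nlinarith
    have h1 := stepMean_cosh_diff_le hij (θ := θ * (1 + 2 * β) ^ t) hy.1 (by
      rw [abs_of_nonneg h0]
      linarith)
    rw [stepMean_const_mul]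
    calc _ ≤ Real.exp (t * ((5 * θ) ^ 2 * (8 * n * β ^ 2))) *
          (Real.exp ((θ * (1 + 2 * β) ^ t) ^ 2 * (8 * n * β ^ 2)) *
          Real.cosh (θ * (1 + 2 * β) ^ t * (1 + 2 * β) * diff y i j)) := by gcongr
      _ ≤ Real.exp (t * ((5 * θ) ^ 2 * (8 * n * β ^ 2))) *
          (Real.exp ((5 * θ) ^ 2 * (8 * n * β ^ 2)) *
          Real.cosh (θ * (1 + 2 * β) ^ t * (1 + 2 * β) * diff y i j)) := by gcongr
      _ = _ := by
          rw [← mul_assoc, ← Real.exp_add, pow_succ]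
          push_cast
          ring_nf

theorem killedMean_exp_frac_le [NeZero n] {β p : ℝ} {T : ℕ}
    (hβ0 : 0 ≤ β) (hβ : β * T ≤ 3 / 4) (l : Fin k) (x : Config n k) :
    killedMean (goodSet n i j β p) (fun y => Real.exp (1 / 5 * (n * frac y l)))
        (fun y => Real.exp (1 / 5 * (n * frac y l))) T x ≤ Real.exp (n * frac x l) := by
  have hnl : ∀ y : Config n k, 0 ≤ n * frac y l := fun y =>
    mul_nonneg (Nat.cast_nonneg _) (frac_nonneg y l)
  refine (killedMean_le_of_super (goodSet n i j β p) (T := T)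
    (h := fun t y => Real.exp (1 / 5 * (1 + 2 * β) ^ t * (n * frac y l)))
    (fun y => ?_) (fun t ht y _ => ?_) (fun t ht y hy => ?_) T le_rfl x).trans ?_
  · simp
  · have := one_le_pow₀ (n := t + 1) (a := 1 + 2 * β) (by linarith)
    have := hnl y
    gcongr
    linarith
  · have h5 := one_add_two_mul_pow_le hβ0 hβ ht.le
    refine (stepMean_exp_frac_le l (hy.1 l) (by positivity) (by linarith)).trans (le_of_eq ?_)
    rw [pow_succ]
    ring_nf
  · have h5 := one_add_two_mul_pow_le hβ0 hβ le_rfl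
    exact Real.exp_le_exp.2 (mul_le_of_le_one_left (hnl x) (by linarith))

/-- With exponents at most `1/15` a round costs a factor `1 - 16β/15`; by Bernoulli the total factor
is at least `1 - (16/15)(3/4) = 1/5`, whence `1/75`. -/
theorem killedMean_exp_neg_frac_le [NeZero n] {β p : ℝ} {T : ℕ} (hβ0 : 0 ≤ β)
    (hβ1 : β ≤ 3 / 4) (hβ : β * T ≤ 3 / 4) (l : Fin k) (x : Config n k) :
    killedMean (goodSet n i j β p) (fun y => Real.exp (-(1 / 15) * (n * frac y l)))
        (fun y => Real.exp (-(1 / 15) * (n * frac y l))) T x ≤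
      Real.exp (-(1 / 75) * (n * frac x l)) := by
  have hnl : ∀ y : Config n k, 0 ≤ n * frac y l := fun y =>
    mul_nonneg (Nat.cast_nonneg _) (frac_nonneg y l)
  have hρ0 : 0 ≤ 1 - β * (16 / 15) := by linarith
  have hρ1 : ∀ t : ℕ, (1 - β * (16 / 15)) ^ t ≤ 1 := fun t => pow_le_one₀ hρ0 (by linarith)
  refine (killedMean_le_of_super (goodSet n i j β p) (T := T)
    (h := fun t y => Real.exp (-(1 / 15 * (1 - β * (16 / 15)) ^ t) * (n * frac y l)))
    (fun y => ?_) (fun t ht y _ => ?_) (fun t ht y hy => ?_) T le_rfl x).trans ?_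
  · simp
  · have := hρ1 (t + 1)
    have := hnl y
    gcongr
    linarith
  · have h1 := hρ1 t
    have h0 := pow_nonneg hρ0 t
    refine (stepMean_exp_neg_frac_le l hy.1 (by positivity) (by linarith)).trans ?_
    have := hnl y
    refine Real.exp_le_exp.2 (mul_le_mul_of_nonneg_right (neg_le_neg ?_) this)
    rw [pow_succ, ← mul_assoc]
    refine mul_le_mul_of_nonneg_left ?_ (by positivity)
    nlinarith
  · have h := one_add_mul_le_pow (a := -(β * (16 / 15))) (by linarith) T
    rw [← sub_eq_add_neg] at h
    have := hnl x
    gcongr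
    linarith

/-- Paley–Zygmund for `cosh (θ D)`. Since `cosh² z ≤ cosh 2z`, the second moment is a first moment
at `2θ`, which the growth factor `5` raises to at most `10θ`. -/
theorem le_killedMean_abs_diff [NeZero n] (hij : i ≠ j) {β p θ v d m m' V : ℝ} {T : ℕ}
    (hp : 0 ≤ p) (hβ0 : 0 ≤ β) (hβ1 : β ≤ 3 / 4) (hβ : β * T ≤ 3 / 4) (hθ0 : 0 ≤ θ)
    (hθ : θ ≤ 1 / 20) (hv : v = n * p ^ 2 / 8192) (x : Config n k) (hd : 0 ≤ d)
    (hm' : Real.cosh (θ * d) ≤ m') (hmm : m' < m)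
    (hm : m ≤ Real.exp (T * (θ ^ 2 * v)) * Real.cosh (θ * diff x i j / 4))
    (hV : Real.exp (T * (θ ^ 2 * v)) ^ 2 * (Real.exp (T * ((10 * θ) ^ 2 * (8 * n * β ^ 2))) *
        Real.cosh (10 * (θ * diff x i j))) ≤ V) :
    (m - m') ^ 2 / V ≤
      killedMean (goodSet n i j β p) (fun y => if d < |diff y i j| then 1 else 0)
        (fun _ => 1) T x := by
  have hv0 : 0 ≤ v := by rw [hv]; positivity
  have hM : 1 ≤ Real.exp (T * (θ ^ 2 * v)) := Real.one_le_exp (by positivity)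
  set M := Real.exp (T * (θ ^ 2 * v)) with hMdef
  have hcsq : ∀ z : ℝ, Real.cosh z ^ 2 ≤ Real.cosh (2 * z) := fun z => by
    rw [Real.cosh_two_mul]
    linarith [sq_nonneg (Real.sinh z)]
  have hVpos : 0 < V := lt_of_lt_of_le (by positivity) hV
  have h1 : m ≤ killedMean (goodSet n i j β p) (fun y => Real.cosh (θ * diff y i j))
      (fun y => M * Real.cosh (θ * diff y i j)) T x := by
    refine hm.trans (le_trans ?_
      (le_killedMean_cosh hij hp hβ0 hβ1 hβ hθ0 (by linarith) hv x))
    gcongr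
    have hq := quarter_le_one_sub_pow hβ0 hβ1 hβ le_rfl
    rw [mul_div_right_comm]
    exact cosh_mul_le_cosh_mul (by positivity) (by nlinarith) _
  have h2 : killedMean (goodSet n i j β p) (fun y => Real.cosh (θ * diff y i j) ^ 2)
      (fun y => (M * Real.cosh (θ * diff y i j)) ^ 2) T x ≤ V := by
    refine le_trans (killedMean_mono _ (F' := fun y => M ^ 2 * Real.cosh (2 * θ * diff y i j))
      (H' := fun y => M ^ 2 * Real.cosh (2 * θ * diff y i j)) (fun y => ?_) (fun y _ => ?_) T x) ?_
    · have := hcsq (θ * diff y i j)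
      rw [← mul_assoc] at this
      exact this.trans (le_mul_of_one_le_left (Real.cosh_pos _).le (one_le_pow₀ hM))
    · have := hcsq (θ * diff y i j)
      rw [← mul_assoc] at this
      rw [mul_pow]
      gcongr
    · rw [killedMean_const_mul]
      refine le_trans ?_ hV
      gcongr
      refine (killedMean_cosh_le hij hβ0 hβ (by positivity) (by linarith) x).trans ?_
      have h5 := one_add_two_mul_pow_le hβ0 hβ le_rfl
      have h10 : (5 * (2 * θ)) ^ 2 = (10 * θ) ^ 2 := by ring
      rw [h10]
      gcongr
      rw [← mul_assoc]
      exact cosh_mul_le_cosh_mul (by positivity) (by nlinarith) _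
  refine (paley_zygmund_killedMean _ ((Real.cosh_pos _).le.trans hm') hmm hVpos h1 h2).trans
    (killedMean_mono _ (fun y => ?_) (fun _ _ => le_rfl) T x)
  split_ifs with ha hb hb
  · exact le_rfl
  · exfalso
    refine absurd (lt_of_le_of_lt hm' ha) (not_lt.2 ?_)
    rw [Real.cosh_le_cosh, abs_mul, abs_mul, abs_of_nonneg hd]
    gcongr
    exact not_lt.1 hb
  · norm_num
  · exact le_rfl

/-! ### Anticoncentration of the difference over a phase. -/

/-- The choice of the parameter of the exponential moments, according to whether the initial
difference `D` is small or large compared to `√s`. -/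
theorem exists_exponent {c A : ℝ} (hc : 0 < c) (hA : 0 < A) :
    ∃ L Q η : ℝ, 0 < L ∧ 0 < η ∧ ∀ s D : ℝ, 0 < s → ∃ θ m m' : ℝ, 0 ≤ θ ∧ θ ^ 2 * s ≤ L ∧
      |θ * D| ≤ Q ∧ m' + η ≤ m ∧ m ≤ Real.exp (c * (θ ^ 2 * s)) * Real.cosh (θ * D / 4) ∧
      Real.cosh (θ * (A * √s)) ≤ m' := by
  obtain ⟨l, hl⟩ : ∃ l : ℝ, l = (A + 1) / c + 1 := ⟨_, rfl⟩
  have hl0 : 0 < l := by rw [hl]; positivity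
  have hl1 : 1 ≤ l := by
    rw [hl]
    have : 0 ≤ (A + 1) / c := by positivity
    linarith
  have hlc : A + 1 ≤ c * l := by
    rw [hl, mul_add, mul_div_cancel₀ _ hc.ne']
    linarith
  have hη : Real.cosh (1 / 8) < Real.cosh (1 / 4) := by
    rw [Real.cosh_lt_cosh, abs_of_nonneg (by norm_num), abs_of_nonneg (by norm_num)]
    norm_num
  refine ⟨max (l ^ 2) (1 / (8 * A) ^ 2), max (8 * A * l) 1,
    min 1 (Real.cosh (1 / 4) - Real.cosh (1 / 8)), by positivity,
    lt_min one_pos (sub_pos.2 hη), fun s D hs => ?_⟩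
  have hσ : 0 < √s := Real.sqrt_pos.2 hs
  have hσ2 : √s ^ 2 = s := Real.sq_sqrt hs.le
  rcases le_or_gt |D| (8 * A * √s) with hD | hD
  -- Noise regime: `θ` is of order `1/√s`, and `l` is so large that the variance factor `exp(c l²)`
  -- beats the threshold value `cosh(l A)` even for zero initial difference.
  · have h2 : (l / √s) ^ 2 * s = l ^ 2 := by
      rw [div_pow, hσ2]
      field_simp
    have h3 : l / √s * (A * √s) = l * A := by field_simp
    refine ⟨l / √s, Real.exp (c * l ^ 2), Real.cosh (l * A), by positivity, ?_, ?_, ?_, ?_, ?_⟩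
    · rw [h2]
      exact le_max_left _ _
    · refine le_max_of_le_left ?_
      rw [abs_mul, abs_of_pos (by positivity), div_mul_eq_mul_div, div_le_iff₀ hσ]
      nlinarith
    · have h4 : Real.cosh (l * A) ≤ Real.exp (l * A) := by
        rw [Real.cosh_eq]
        have : Real.exp (-(l * A)) ≤ Real.exp (l * A) := by
          gcongr
          nlinarith [mul_pos hl0 hA]
        linarith
      have h5 : Real.exp (l * A) * 2 ≤ Real.exp (c * l ^ 2) := by
        calc Real.exp (l * A) * 2 ≤ Real.exp (l * A) * Real.exp 1 := by
              gcongr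
              linarith [Real.add_one_le_exp (1 : ℝ)]
          _ = Real.exp (l * A + 1) := (Real.exp_add _ _).symm
          _ ≤ _ := by
              gcongr
              nlinarith
      have h6 : 1 ≤ Real.exp (l * A) := Real.one_le_exp (by positivity)
      have := min_le_left 1 (Real.cosh (1 / 4) - Real.cosh (1 / 8))
      linarith
    · rw [h2]
      exact le_mul_of_one_le_right (Real.exp_pos _).le (Real.one_le_cosh _)
    · rw [h3]
  -- Drift regime: the initial difference survives up to a factor `4`, while the threshold `A √s` is
  -- below `|D|/8`; hence `cosh (1/4)` against `cosh (1/8)`.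
  · have hD0 : 0 < |D| := lt_trans (by positivity) hD
    have h1 : |(|D|⁻¹ * D)| = 1 := by
      rw [abs_mul, abs_inv, abs_abs, inv_mul_cancel₀ hD0.ne']
    refine ⟨|D|⁻¹, Real.cosh (1 / 4), Real.cosh (1 / 8), by positivity, ?_, ?_, ?_, ?_, ?_⟩
    · refine le_max_of_le_right ?_
      rw [inv_pow, ← hσ2, inv_mul_le_iff₀ (by positivity), mul_one_div, le_div_iff₀ (by positivity),
        ← mul_pow]
      refine pow_le_pow_left₀ (by positivity) ?_ 2
      linarith
    · rw [h1]
      exact le_max_right _ _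
    · have := min_le_right 1 (Real.cosh (1 / 4) - Real.cosh (1 / 8))
      linarith
    · refine le_trans (le_of_eq ?_) (le_mul_of_one_le_left (Real.cosh_pos _).le
        (Real.one_le_exp (by positivity)))
      rw [← Real.cosh_abs (|D|⁻¹ * D / 4), abs_div, h1, abs_of_pos (by norm_num : (0 : ℝ) < 4)]
    · have h2 : 0 ≤ |D|⁻¹ * (A * √s) := by positivity
      rw [Real.cosh_le_cosh, abs_of_nonneg h2, abs_of_nonneg (by norm_num : (0 : ℝ) ≤ 1 / 8),
        inv_mul_le_iff₀ hD0]
      linarith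

/-- During a phase, the difference of two opinions exceeds any given multiple of `√(n / κ)` with
a probability bounded below, provided that the dynamics stays good. -/
theorem exists_le_killedMean_abs_diff {δ A : ℝ} (hδ : 0 < δ) (hA : 0 < A) :
    ∃ L c : ℝ, 0 < c ∧ ∀ (n k : ℕ) [NeZero n] (i j : Fin k) (κ T : ℕ) (β : ℝ) (x : Config n k),
      i ≠ j → 2 ≤ κ → 0 ≤ β → β ≤ 3 / 4 → β ≤ 8 / κ → β * T ≤ 3 / 4 → δ * κ ≤ T → T ≤ κ →
      L ≤ (n : ℝ) / κ →
      c ≤ killedMean (goodSet n i j β (0.03 / κ))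
        (fun y => if A * √((n : ℝ) / κ) < |diff y i j| then 1 else 0) (fun _ => 1) T x := by
  obtain ⟨L, Q, η, hL, hη, h⟩ := exists_exponent (c := δ * (0.0009 / 8192)) (by positivity) hA
  -- The bound `400 L ≤ n/κ` forces `θ ≤ 1/20`. In `51202`, the summand `100 * 8 * 64` comes from
  -- the second moment with `β ≤ 8/κ`, and `2` from the squared killing factor.
  refine ⟨400 * L, η ^ 2 / (Real.exp (51202 * L) * Real.cosh (10 * Q)), by positivity, ?_⟩
  intro n k _ i j κ T β x hij hκ hβ0 hβ1 hβκ hβT hδT hTκ hn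
  have hκ0 : (0 : ℝ) < κ := by
    have : 0 < κ := by omega
    exact_mod_cast this
  have hTκ' : (T : ℝ) ≤ κ := by exact_mod_cast hTκ
  set s := (n : ℝ) / κ with hs
  have hs0 : 0 < s := lt_of_lt_of_le (by positivity) hn
  have hns : (n : ℝ) = s * κ := by rw [hs]; field_simp
  obtain ⟨θ, m, m', hθ0, hθL, hθQ, hmm, hm, hm'⟩ := h s (diff x i j) hs0
  have hθ : θ ≤ 1 / 20 := by
    by_contra hcon
    push Not at hcon
    have : 1 / 400 < θ ^ 2 := by nlinarith
    nlinarith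
  have hv : (n : ℝ) * (0.03 / κ) ^ 2 / 8192 = 0.0009 / 8192 * s / κ := by
    rw [hns]
    field_simp
    norm_num
  have hlow : δ * (0.0009 / 8192) * (θ ^ 2 * s) ≤
      T * (θ ^ 2 * ((n : ℝ) * (0.03 / κ) ^ 2 / 8192)) := by
    rw [hv]
    calc _ = δ * κ * (θ ^ 2 * (0.0009 / 8192 * s / κ)) := by field_simp
      _ ≤ _ := by gcongr
  have hup : T * (θ ^ 2 * ((n : ℝ) * (0.03 / κ) ^ 2 / 8192)) ≤ L := by
    rw [hv]
    calc _ ≤ κ * (θ ^ 2 * (0.0009 / 8192 * s / κ)) := by gcongr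
      _ = 0.0009 / 8192 * (θ ^ 2 * s) := by field_simp
      _ ≤ 1 * (θ ^ 2 * s) := by gcongr; norm_num
      _ ≤ L := by linarith
  have hup' : T * ((10 * θ) ^ 2 * (8 * n * β ^ 2)) ≤ 51200 * L := by
    calc _ ≤ κ * ((10 * θ) ^ 2 * (8 * (s * κ) * (8 / κ) ^ 2)) := by
          rw [hns]
          gcongr
      _ = 51200 * (θ ^ 2 * s) := by field_simp; ring
      _ ≤ 51200 * L := by gcongr
  refine le_trans ?_ (le_killedMean_abs_diff hij (by positivity) hβ0 hβ1 hβT hθ0 hθ rfl x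
    (d := A * √s) (by positivity) hm' (by linarith) (m := m)
    (V := Real.exp (51202 * L) * Real.cosh (10 * Q)) (hm.trans (by gcongr)) ?_)
  · gcongr
    linarith
  · rw [← Real.exp_nat_mul, ← mul_assoc, ← Real.exp_add]
    have hcosh : Real.cosh (10 * (θ * diff x i j)) ≤ Real.cosh (10 * Q) := by
      rw [Real.cosh_le_cosh, abs_mul, abs_mul 10 Q]
      exact mul_le_mul_of_nonneg_left (hθQ.trans (le_abs_self _)) (abs_nonneg _)
    gcongr
    push_cast
    linarith

/-! ### Initial fractions, and gaps from differences. -/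

theorem frac_le_maxFrac (x : Config n k) (l : Fin k) : frac x l ≤ maxFrac x :=
  le_ciSup (f := fun l => frac x l) (Set.finite_range _).bddAbove l

/-- Super-weak opinions hold at most `1/10` of the nodes in total, so at most `κ` opinions share the
remaining `0.9`. Strong opinions thus start with at least `0.18/κ`. -/
theorem le_maxFrac [NeZero n] {x : Config n k} {κ : ℕ} (hκ : 0 < κ)
    (h : {l : Fin k | ¬ IsSuperWeak x l}.ncard ≤ κ) : 0.9 / (κ : ℝ) ≤ maxFrac x := by
  classical
  have hκ0 : (0 : ℝ) < κ := by exact_mod_cast hκ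
  have hM : 0 ≤ maxFrac x := Real.iSup_nonneg fun l => frac_nonneg x l
  have hcard : ((Finset.univ.filter fun l => ¬ IsSuperWeak x l).card : ℝ) ≤ κ := by
    rw [← Set.ncard_coe_finset]
    simpa using h
  have h1 : ∑ l with IsSuperWeak x l, frac x l ≤ 1 / 10 := by
    calc _ ≤ ∑ l : Fin k with IsSuperWeak x l, 1 / (10 * (k : ℝ)) :=
          Finset.sum_le_sum fun l hl => (Finset.mem_filter.1 hl).2
      _ ≤ ∑ l : Fin k, 1 / (10 * (k : ℝ)) :=
          Finset.sum_le_sum_of_subset_of_nonneg (Finset.filter_subset _ _)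
            fun _ _ _ => by positivity
      _ ≤ 1 / 10 := by
          rw [Finset.sum_const, Finset.card_univ, Fintype.card_fin, nsmul_eq_mul]
          rcases Nat.eq_zero_or_pos k with hk | hk
          · simp [hk]
          · have : (0 : ℝ) < k := by exact_mod_cast hk
            exact le_of_eq (by field_simp)
  have h2 : ∑ l with ¬ IsSuperWeak x l, frac x l ≤ κ * maxFrac x := by
    calc _ ≤ ∑ l : Fin k with ¬ IsSuperWeak x l, maxFrac x :=
          Finset.sum_le_sum fun l _ => frac_le_maxFrac x l
      _ ≤ _ := by
          rw [Finset.sum_const, nsmul_eq_mul]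
          gcongr
  have h3 := Finset.sum_filter_add_sum_filter_not Finset.univ (fun l => IsSuperWeak x l)
    fun l => frac x l
  rw [sum_frac] at h3
  rw [div_le_iff₀ hκ0]
  linarith

theorem frac_add_frac_le_one [NeZero n] (x : Config n k) (hij : i ≠ j) :
    frac x i + frac x j ≤ 1 := by
  rw [← sum_frac x, ← Finset.sum_pair hij]
  exact Finset.sum_le_sum_of_subset_of_nonneg (Finset.subset_univ _)
    fun l _ _ => frac_nonneg x l

theorem le_gap [NeZero n] {y : Config n k} {C δ κ : ℝ} (hδ : 0 < δ) (hκ : 0 < κ)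
    (hj0 : 0 < frac y j) (hj : frac y j ≤ 1 / (δ * κ))
    (hd : C / δ * √(n / κ) ≤ diff y i j) (hC : 0 < C) : C / √(n / κ) ≤ gap y i j := by
  have hn : (0 : ℝ) < n := by exact_mod_cast Nat.pos_of_ne_zero (NeZero.ne n)
  have hσ : 0 < √(n / κ) := Real.sqrt_pos.2 (by positivity)
  have hσ2 : √(n / κ) * √(n / κ) = n / κ := Real.mul_self_sqrt (by positivity)
  rw [gap, le_div_iff₀ hj0, div_mul_eq_mul_div, div_le_iff₀ hσ]
  have h1 : C * frac y j ≤ C * (1 / (δ * κ)) := by gcongr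
  refine h1.trans ?_
  have h2 : C / δ * (n / κ) ≤ n * ((frac y i - frac y j) * √(n / κ)) := by
    calc C / δ * (n / κ) = C / δ * √(n / κ) * √(n / κ) := by rw [mul_assoc, hσ2]
      _ ≤ diff y i j * √(n / κ) := by gcongr
      _ = _ := by rw [diff, mul_assoc]
  have h3 : C / δ * (n / κ) = n * (C * (1 / (δ * κ))) := by field_simp
  rw [h3] at h2
  exact le_of_mul_le_mul_left h2 hn

theorem le_max_gap [NeZero n] {y : Config n k} {C δ κ : ℝ} (hδ : 0 < δ) (hκ : 0 < κ) (hC : 0 < C)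
    (hi0 : 0 < frac y i) (hj0 : 0 < frac y j)
    (hle : min (frac y i) (frac y j) ≤ 1 / (δ * κ))
    (hd : C / δ * √(n / κ) < |diff y i j|) :
    C / √(n / κ) ≤ max (gap y i j) (gap y j i) := by
  have hn : (0 : ℝ) ≤ n := Nat.cast_nonneg _
  rcases le_total (frac y j) (frac y i) with h | h
  · rw [min_eq_right h] at hle
    rw [diff, abs_of_nonneg (mul_nonneg hn (sub_nonneg.2 h))] at hd
    exact le_max_of_le_left (le_gap hδ hκ hj0 hle hd.le hC)
  · rw [min_eq_left h] at hle
    rw [diff, abs_of_nonpos (mul_nonpos_of_nonneg_of_nonpos hn (sub_nonpos.2 h))] at hd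
    refine le_max_of_le_right (le_gap hδ hκ hi0 hle (hd.le.trans (le_of_eq ?_)) hC)
    unfold diff
    ring

/-! ### Probability of leaving the good set, and conclusion for one phase. -/

/-- The potential that bounds the probability that one of `i` and `j` becomes small. -/
noncomputable def smallPotential (i j : Fin k) (s : ℝ) (y : Config n k) : ℝ :=
  Real.exp (1 / 15 * (0.03 * s)) *
    (Real.exp (-(1 / 15) * (n * frac y i)) + Real.exp (-(1 / 15) * (n * frac y j)))

/-- The potential that bounds the probability that some opinion becomes large. -/
noncomputable def largePotential (s : ℝ) (y : Config n k) : ℝ :=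
  Real.exp (-(1 / 5 * (8 * s))) * ∑ l, Real.exp (1 / 5 * (n * frac y l))

theorem smallPotential_nonneg (s : ℝ) (y : Config n k) : 0 ≤ smallPotential i j s y := by
  unfold smallPotential
  positivity

theorem largePotential_nonneg (s : ℝ) (y : Config n k) : 0 ≤ largePotential s y := by
  unfold largePotential
  positivity

theorem one_le_smallPotential {s : ℝ} {y : Config n k}
    (h : n * frac y i ≤ 0.03 * s ∨ n * frac y j ≤ 0.03 * s) :
    1 ≤ smallPotential i j s y := by
  unfold smallPotential
  rw [mul_add, ← Real.exp_add, ← Real.exp_add]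
  have h1 := Real.exp_pos (1 / 15 * (0.03 * s) + -(1 / 15) * (n * frac y i))
  have h2 := Real.exp_pos (1 / 15 * (0.03 * s) + -(1 / 15) * (n * frac y j))
  rcases h with h | h
  · linarith [Real.one_le_exp (x := 1 / 15 * (0.03 * s) + -(1 / 15) * (n * frac y i))
      (by linarith)]
  · linarith [Real.one_le_exp (x := 1 / 15 * (0.03 * s) + -(1 / 15) * (n * frac y j))
      (by linarith)]

theorem one_le_largePotential {s : ℝ} {y : Config n k} {l : Fin k}
    (h : 8 * s ≤ n * frac y l) : 1 ≤ largePotential s y := by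
  unfold largePotential
  calc 1 ≤ Real.exp (-(1 / 5 * (8 * s))) * Real.exp (1 / 5 * (n * frac y l)) := by
        rw [← Real.exp_add]
        exact Real.one_le_exp (by linarith)
    _ ≤ _ := by
        gcongr
        exact Finset.single_le_sum (f := fun l => Real.exp (1 / 5 * (n * frac y l)))
          (fun l _ => (Real.exp_pos _).le) (Finset.mem_univ l)

/-- The rate is `0.18/75 - 0.03/15 = 1/2500`. -/
theorem killedMean_smallPotential_le [NeZero n] {β p s : ℝ} {T : ℕ} {x : Config n k} (hβ0 : 0 ≤ β)
    (hβ1 : β ≤ 3 / 4) (hβ : β * T ≤ 3 / 4) (hi : 0.18 * s ≤ n * frac x i)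
    (hj : 0.18 * s ≤ n * frac x j) :
    killedMean (goodSet n i j β p) (smallPotential i j s) (smallPotential i j s) T x ≤
      2 * Real.exp (-s / 2500) := by
  unfold smallPotential
  rw [killedMean_const_mul, killedMean_add]
  have h1 := killedMean_exp_neg_frac_le (i := i) (j := j) (p := p) hβ0 hβ1 hβ i x
  have h2 := killedMean_exp_neg_frac_le (i := i) (j := j) (p := p) hβ0 hβ1 hβ j x
  have h3 : ∀ z : ℝ, 0.18 * s ≤ z → Real.exp (-(1 / 75) * z) ≤ Real.exp (-(1 / 75) * (0.18 * s)) :=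
    fun z hz => Real.exp_le_exp.2 (by linarith)
  calc _ ≤ Real.exp (1 / 15 * (0.03 * s)) *
        (Real.exp (-(1 / 75) * (0.18 * s)) + Real.exp (-(1 / 75) * (0.18 * s))) := by
        gcongr
        · exact h1.trans (h3 _ hi)
        · exact h2.trans (h3 _ hj)
    _ = 2 * Real.exp (1 / 15 * (0.03 * s) + -(1 / 75) * (0.18 * s)) := by
        rw [Real.exp_add]
        ring
    _ ≤ _ := by
        gcongr
        linarith

theorem killedMean_largePotential_le [NeZero n] {β p s : ℝ} {T : ℕ} {x : Config n k} (hβ0 : 0 ≤ β)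
    (hβ : β * T ≤ 3 / 4) (hs : 0 ≤ s) (hl : ∀ l, n * frac x l ≤ 1.5 * s) :
    killedMean (goodSet n i j β p) (largePotential s) (largePotential s) T x ≤
      k * Real.exp (-s / 2500) := by
  unfold largePotential
  rw [killedMean_const_mul, killedMean_sum]
  calc _ ≤ Real.exp (-(1 / 5 * (8 * s))) * ∑ l : Fin k, Real.exp (1.5 * s) := by
        gcongr with l
        exact (killedMean_exp_frac_le hβ0 hβ l x).trans (Real.exp_le_exp.2 (hl l))
    _ = k * Real.exp (-(1 / 5 * (8 * s)) + 1.5 * s) := by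
        rw [Finset.sum_const, Finset.card_univ, Fintype.card_fin, nsmul_eq_mul, Real.exp_add]
        ring
    _ ≤ _ := by
        gcongr
        linarith

open Classical in
/-- At the end of a phase the gap is large with a probability bounded below, up to the probability
that the dynamics leaves the good set. -/
theorem exists_le_rounds_real {δ C : ℝ} (hδ : 0 < δ) (hδ1 : δ ≤ 1 / 32) (hC : 0 < C) :
    ∃ L c : ℝ, 0 < c ∧ ∀ (n k : ℕ) [NeZero n] (κ : ℕ) (x : Config n k), 2 ≤ κ →
      L ≤ (n : ℝ) / κ → {l : Fin k | ¬ IsSuperWeak x l}.ncard ≤ κ →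
      maxFrac x ≤ 1.5 / (κ : ℝ) → ∀ i j : Fin k, i ≠ j → IsStrong x i → IsStrong x j →
      c - (k + 2) * Real.exp (-((n : ℝ) / κ) / 2500) ≤
        (rounds (phaseLength δ κ) x).toMeasure.real
          {y | C / √((n : ℝ) / κ) ≤ max (gap y i j) (gap y j i)} := by
  obtain ⟨L, c, hc, h⟩ := exists_le_killedMean_abs_diff (A := C / δ) hδ (by positivity)
  refine ⟨L, c, hc, fun n k _ κ x hκ hL hweak hmax i j hij hi hj => ?_⟩
  have hn : (0 : ℝ) < n := by exact_mod_cast Nat.pos_of_ne_zero (NeZero.ne n)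
  have hκ2 : (2 : ℝ) ≤ κ := by exact_mod_cast hκ
  have hκ0 : (0 : ℝ) < κ := by linarith
  set s := (n : ℝ) / κ with hs
  have hs0 : 0 < s := by positivity
  have hns : (n : ℝ) = s * κ := by rw [hs]; field_simp
  set T := phaseLength δ κ with hT
  have hδT : δ * κ ≤ T := Nat.le_ceil _
  have hT1 : 1 ≤ T := Nat.one_le_ceil_iff.2 (by positivity)
  have hTlt : (T : ℝ) < δ * κ + 1 := Nat.ceil_lt_add_one (by positivity)
  have hTκ : T ≤ κ := by
    have : (T : ℝ) ≤ κ := by nlinarith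
    exact_mod_cast this
  have hfl : ∀ l, frac x l ≤ 1.5 / κ := fun l => (frac_le_maxFrac x l).trans hmax
  have hstrong : ∀ l, IsStrong x l → 0.18 / κ ≤ frac x l := by
    intro l hl
    have h1 := le_maxFrac (by omega) hweak
    have h2 : maxFrac x / 5 ≤ frac x l := hl
    have h3 : (0.18 : ℝ) / κ = 0.9 / κ / 5 := by ring
    rw [h3]
    linarith
  have hsi : ∀ l, IsStrong x l → 0.18 * s ≤ n * frac x l := by
    intro l hl
    calc 0.18 * s = n * (0.18 / κ) := by rw [hs]; ring
      _ ≤ _ := by gcongr; exact hstrong l hl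
  set A := {y : Config n k | C / √s ≤ max (gap y i j) (gap y j i)} with hA
  have hgap : ∀ y : Config n k, 0.03 * s < n * frac y i → 0.03 * s < n * frac y j →
      min (frac y i) (frac y j) ≤ 1 / (δ * κ) → C / δ * √s < |diff y i j| → y ∈ A := by
    intro y h1 h2 h3 h4
    have hpos : ∀ z : ℝ, 0.03 * s < n * z → 0 < z := fun z hz =>
      pos_of_mul_pos_right (lt_trans (by positivity) hz) hn.le
    exact le_max_gap hδ hκ0 hC (hpos _ h1) (hpos _ h2) h3 h4
  rcases Nat.eq_or_lt_of_le hT1 with hT' | hT'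
  · -- a single round: only its outcome can be bad
    have hβ1 : 1.5 / (κ : ℝ) ≤ 3 / 4 := by
      rw [div_le_iff₀ hκ0]
      linarith
    have hβT : 1.5 / (κ : ℝ) * T ≤ 3 / 4 := by simpa [← hT'] using hβ1
    have hδκ : δ * κ ≤ 1 := by simpa [← hT'] using hδT
    have h1 := h n k i j κ T (1.5 / κ) x hij hκ (by positivity) hβ1 (by gcongr; norm_num) hβT hδT
      hTκ hL
    have hx : x ∈ goodSet n i j (1.5 / κ) (0.03 / κ) := by
      refine ⟨hfl, le_trans ?_ (hstrong i hi), le_trans ?_ (hstrong j hj)⟩ <;>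
      · gcongr
        norm_num
    -- Killing is tested only at the start, which is good, so the payoff at killing can be changed
    -- freely.
    have h2 : ∀ H H' : Config n k → ℝ, ∀ F, killedMean (goodSet n i j (1.5 / κ) (0.03 / κ)) F H T x =
        killedMean (goodSet n i j (1.5 / κ) (0.03 / κ)) F H' T x := by
      intro H H' F
      rw [← hT']
      simp only [killedMean, if_pos hx]
    rw [h2 _ (fun y => 0 + smallPotential i j s y)] at h1
    have h3 := killedMean_mono (goodSet n i j (1.5 / κ) (0.03 / κ))
      (F := fun y => if C / δ * √s < |diff y i j| then 1 else 0)
      (F' := fun y => (if y ∈ A then 1 else 0) + smallPotential i j s y)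
      (H := fun y => 0 + smallPotential i j s y)
      (H' := fun y => 0 + smallPotential i j s y) (fun y => by
        have hψ := smallPotential_nonneg (i := i) (j := j) s y
        split_ifs with ha hb hb
        · linarith
        · rw [zero_add]
          apply one_le_smallPotential
          by_contra! hcon
          refine hb (hgap y hcon.1 hcon.2 ?_ ha)
          have := frac_add_frac_le_one y hij
          -- A single round means `δ κ ≤ 1`, so the trivial bound `p_i ≤ 1` suffices.
          have h5 : 1 ≤ 1 / (δ * κ) := by rwa [le_div_iff₀ (by positivity), one_mul]
          exact (min_le_left _ _).trans ((frac_le_one y i).trans h5)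
        · linarith
        · linarith) (fun y _ => le_rfl) T x
    rw [killedMean_add] at h3
    have h4 := killedMean_le_rounds_real (goodSet n i j (1.5 / κ) (0.03 / κ)) A T x
    have h5 := killedMean_smallPotential_le (i := i) (j := j) (p := 0.03 / κ) (x := x)
      (by positivity) hβ1 hβT (hsi i hi) (hsi j hj)
    have h6 : 0 ≤ (k : ℝ) * Real.exp (-s / 2500) := by positivity
    linarith
  · have hT2 : (2 : ℝ) ≤ T := by exact_mod_cast hT'
    -- At least two rounds means `δ κ > 1`; with `δ ≤ 1/32` this makes the cap `8/κ` small enough.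
    have hκ32 : (32 : ℝ) < κ := by nlinarith
    have hβ1 : 8 / (κ : ℝ) ≤ 3 / 4 := by
      rw [div_le_iff₀ hκ0]
      linarith
    have hβT : 8 / (κ : ℝ) * T ≤ 3 / 4 := by
      rw [div_mul_eq_mul_div, div_le_iff₀ hκ0]
      nlinarith
    have h1 := h n k i j κ T (8 / κ) x hij hκ (by positivity) hβ1 le_rfl hβT hδT hTκ hL
    have h3 := killedMean_mono (goodSet n i j (8 / κ) (0.03 / κ))
      (F := fun y => if C / δ * √s < |diff y i j| then 1 else 0)
      (F' := fun y => ((if y ∈ A then 1 else 0) + smallPotential i j s y) + largePotential s y)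
      (H := fun _ => 1)
      (H' := fun y => (0 + smallPotential i j s y) + largePotential s y) (fun y => by
        have hψ := smallPotential_nonneg (i := i) (j := j) s y
        have hψ' := largePotential_nonneg s y
        split_ifs with ha hb hb
        · linarith
        -- The configuration at time `T` is not tested for killing, so the potentials must also
        -- cover a bad final configuration.
        · by_cases hcon : n * frac y i ≤ 0.03 * s ∨ n * frac y j ≤ 0.03 * s
          · linarith [one_le_smallPotential hcon]
          by_cases hcon' : 8 * s ≤ n * frac y i
          · linarith [one_le_largePotential hcon']
          push Not at hcon hcon'
          refine absurd (hgap y hcon.1 hcon.2 ((min_le_left _ _).trans ?_) ha) hb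
          -- Here `p_i < 8/κ ≤ 1/(δ κ)`, because `8 δ ≤ 1/4`.
          rw [le_div_iff₀ (by positivity)]
          rw [hns, mul_comm s, mul_assoc, mul_left_comm, mul_comm 8 s] at hcon'
          have h8 : κ * frac y i < 8 := lt_of_mul_lt_mul_left hcon' hs0.le
          nlinarith
        · linarith
        · linarith) (fun y hy => by
        have hψ := smallPotential_nonneg (i := i) (j := j) s y
        have hψ' := largePotential_nonneg s y
        have hsmall : ∀ l, frac y l < 0.03 / κ → n * frac y l ≤ 0.03 * s := by
          intro l hl
          calc n * frac y l ≤ n * (0.03 / κ) := by gcongr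
            _ = 0.03 * s := by rw [hs]; ring
        by_cases hcon : n * frac y i ≤ 0.03 * s ∨ n * frac y j ≤ 0.03 * s
        · linarith [one_le_smallPotential hcon]
        · have hl : ∃ l, 8 / κ < frac y l := by
            by_contra! hcon'
            refine hy ⟨hcon', ?_, ?_⟩
            · by_contra! h0
              exact hcon (Or.inl (hsmall i h0))
            · by_contra! h0
              exact hcon (Or.inr (hsmall j h0))
          obtain ⟨l, hl⟩ := hl
          have : 8 * s ≤ n * frac y l := by
            calc 8 * s = n * (8 / κ) := by rw [hs]; ring
              _ ≤ n * frac y l := by gcongr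
          linarith [one_le_largePotential this]) T x
    rw [killedMean_add, killedMean_add] at h3
    have h4 := killedMean_le_rounds_real (goodSet n i j (8 / κ) (0.03 / κ)) A T x
    have h5 := killedMean_smallPotential_le (i := i) (j := j) (p := 0.03 / κ) (x := x)
      (by positivity) hβ1 hβT (hsi i hi) (hsi j hj)
    have h6 := killedMean_largePotential_le (i := i) (j := j) (p := 0.03 / κ) (x := x)
      (by positivity) hβT hs0.le (fun l => by
        calc n * frac x l ≤ n * (1.5 / κ) := by gcongr; exact hfl l
          _ = 1.5 * s := by rw [hs]; ring)
    linarith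

/-! ### The threshold `n₀` and the theorem. -/

theorem epochSize_le (k e : ℕ) : epochSize k e ≤ k := by
  refine Nat.floor_le_of_le ?_
  exact mul_le_of_le_one_right (Nat.cast_nonneg k) (pow_le_one₀ (by norm_num) (by norm_num))

/-- Since `k = O(√n)`, the error terms of a phase vanish. -/
theorem exists_threshold {K c : ℝ} (L : ℝ) (hK : 0 < K) (hc : 0 < c) :
    ∃ n₀ : ℕ, ∀ n k κ : ℕ, n₀ ≤ n → (k : ℝ) ≤ K * √((n : ℝ) / Real.log n) → κ ≤ k → 2 ≤ κ →
      L ≤ (n : ℝ) / κ ∧ (k + 2) * Real.exp (-((n : ℝ) / κ) / 2500) ≤ c := by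
  obtain ⟨R, hR⟩ : ∃ R : ℝ, R = max (K * L) (4 * K * (2500 * K) ^ 2 / c) := ⟨_, rfl⟩
  refine ⟨max 3 ⌈R ^ 2⌉₊, fun n k κ hn hk hκk hκ => ?_⟩
  have hn3 : (3 : ℝ) ≤ n := by exact_mod_cast (le_max_left _ _).trans hn
  have hnR : R ^ 2 ≤ n := (Nat.le_ceil _).trans (by exact_mod_cast (le_max_right _ _).trans hn)
  have hr : R ≤ √n := Real.le_sqrt_of_sq_le hnR
  have hr0 : 0 < √(n : ℝ) := Real.sqrt_pos.2 (by linarith)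
  have hr2 : √(n : ℝ) * √n = n := Real.mul_self_sqrt (by linarith)
  have hlog : 1 ≤ Real.log n := by
    rw [Real.le_log_iff_exp_le (by linarith)]
    linarith [Real.exp_one_lt_d9]
  have hkr : (k : ℝ) ≤ K * √n := by
    refine hk.trans ?_
    gcongr
    exact div_le_self (by linarith) hlog
  have hκ0 : (0 : ℝ) < κ := by
    have : 0 < κ := by omega
    exact_mod_cast this
  have hκk' : (κ : ℝ) ≤ k := by exact_mod_cast hκk
  have hk2 : (2 : ℝ) ≤ k := by exact_mod_cast hκ.trans hκk
  have hs : √n / K ≤ n / κ := by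
    rw [div_le_div_iff₀ hK hκ0]
    have : √(n : ℝ) * κ ≤ √n * (K * √n) := by
      gcongr
      linarith
    rwa [mul_left_comm, hr2, mul_comm K] at this
  constructor
  · refine le_trans ?_ hs
    rw [le_div_iff₀ hK, mul_comm]
    exact (le_max_left _ _).trans (hR ▸ hr)
  -- Since `n/κ ≥ √n/K`, the error is at most `2 K √n * exp(-u)`, and `exp(-u) ≤ 2/u²` makes it
  -- `O(1/√n)`.
  · obtain ⟨u, hu⟩ : ∃ u : ℝ, u = √n / (2500 * K) := ⟨_, rfl⟩
    have hu0 : 0 < u := by rw [hu]; positivity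
    have h1 : Real.exp (-((n : ℝ) / κ) / 2500) ≤ Real.exp (-u) := by
      gcongr
      rw [neg_div, hu, mul_comm, ← div_div]
      gcongr
    have h2 : Real.exp (-u) ≤ 2 / u ^ 2 := by
      rw [Real.exp_neg, inv_le_comm₀ (Real.exp_pos _) (by positivity), inv_div]
      linarith [Real.quadratic_le_exp_of_nonneg hu0.le]
    have h3 : 4 * K * (2500 * K) ^ 2 / c ≤ √n := (le_max_right _ _).trans (hR ▸ hr)
    calc _ ≤ (2 * (K * √n)) * (2 / u ^ 2) := by
          gcongr
          · linarith
          · exact h1.trans h2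
      _ = 4 * K * (2500 * K) ^ 2 / √n := by
          rw [hu]
          field_simp
          norm_num
      _ ≤ c := by
          rw [div_le_iff₀ hc] at h3
          rw [div_le_iff₀ hr0]
          linarith

end ThreeMajority

/-- The event already forces `p_i, p_j > 0`: division by zero gives zero, so if either fraction
vanishes then both gaps are at most `0`, below the positive threshold. -/
theorem mainTheorem5 :
    ∃ δ₀ : ℝ, 0 < δ₀ ∧ ∀ δ : ℝ, 0 < δ → δ ≤ δ₀ →
      ∀ C₁ : ℝ, 0 < C₁ → ∃ C₂ : ℝ, 0 < C₂ ∧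
        ∀ K : ℝ, 0 < K → ∃ n₀ : ℕ, ∀ (n : ℕ) [NeZero n] (k e κ : ℕ), n₀ ≤ n →
          (k : ℝ) ≤ K * Real.sqrt ((n : ℝ) / Real.log n) →
          1 ≤ e → κ = ThreeMajority.epochSize k e → 2 ≤ κ →
          ∀ x : ThreeMajority.Config n k,
            {l : Fin k | ¬ ThreeMajority.IsSuperWeak x l}.ncard ≤ κ →
            ThreeMajority.maxFrac x ≤ 1.5 / (κ : ℝ) →
            ∀ i j : Fin k, i ≠ j →
              ThreeMajority.IsStrong x i → ThreeMajority.IsStrong x j →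
              C₂ ≤ (ThreeMajority.rounds (ThreeMajority.phaseLength δ κ) x).toMeasure.real
                {y : ThreeMajority.Config n k |
                  C₁ / Real.sqrt ((n : ℝ) / (κ : ℝ)) ≤
                    max (ThreeMajority.gap y i j) (ThreeMajority.gap y j i)} := by
  refine ⟨1 / 32, by norm_num, fun δ hδ hδ1 C₁ hC₁ => ?_⟩
  obtain ⟨L, c, hc, h⟩ := ThreeMajority.exists_le_rounds_real hδ hδ1 hC₁
  refine ⟨c / 2, by positivity, fun K hK => ?_⟩
  obtain ⟨n₀, hn₀⟩ := ThreeMajority.exists_threshold (c := c / 2) L hK (by positivity)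
  refine ⟨n₀, fun n _ k e κ hn hk _ hκe hκ x hweak hmax i j hij hi hj => ?_⟩
  obtain ⟨h1, h2⟩ := hn₀ n k κ hn hk (hκe ▸ ThreeMajority.epochSize_le k e) hκ
  have h3 := h n k κ x hκ h1 hweak hmax i j hij hi hj
  linarith
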